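/- Let $k$ be a field and let $A$ be a (unital, associative) $k$-algebra with enveloping algebra $A^e = A \otimes_k A^{\mathrm{op}}$. Bimodules are $k$-central; an $(A,A)$-bimodule $M$ is regarded as a left or right $A^e$-module via $(a \otimes b^{\mathrm{op}}) m = amb = m (b \otimes a^{\mathrm{op}})$. An $(A,A)$-bimodule $U$ is invertible if there is an $(A,A)$-bimodule $V$ with $U \otimes_A V \cong A \cong V \otimes_A U$ as bimodules. The algebra $A$ is homologically smooth if the left $A^e$-module $A$ has a projective resolution of finite length by finitely generated projective modules. For an integer $d \ge 0$, $A$ is twisted Calabi-Yau of dimension $d$ with Nakayama bimodule $U$ if $A$ is homologically smooth, $U$ is an invertible $(A,A)$-bimodule, $\operatorname{Ext}^i_{A^e}(A, A^e) = 0$ for all $i \neq d$, and $\operatorname{Ext}^d_{A^e}(A, A^e) \cong U$ as $(A,A)$-bimodules, where the right $A^e$-module structure on $\operatorname{Ext}^i_{A^e}(A,A^e)$ comes from that of $A^e$. It is twisted Calabi-Yau of dimension $d$ if this holds for some $U$. (1) Let $U$ be an invertible $(A,A)$-bimodule and $d \ge 0$. Then $A$ is twisted Calabi-Yau of dimension $d$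 with Nakayama bimodule $U$ if and only if $A$ is homologically smooth and, for every $k$-algebra $C$ and every $0 \le i \le d$, there is a natural isomorphism $$\operatorname{Tor}_i^{A^e}(U, -) \cong \operatorname{Ext}^{d-i}_{A^e}(A, -)$$ of functors from left $(A^e \otimes_k C^{\mathrm{op}})$-modules to right $C$-modules. (2) Consequently, being twisted Calabi-Yau of dimension $d$ is invariant under $k$-linear Morita equivalence: if $B$ is a $k$-algebra such that there is a $k$-linear equivalence between the categories of left $A$-modules and left $B$-modules, then $A$ is twisted Calabi-Yau of dimension $d$ if and only if $B$ is. -/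

import Mathlib

open CategoryTheory TensorProduct MulOpposite

universe u v

noncomputable section

namespace TwistedCY

/-! ### Tensor products and Tor over a noncommutative ring -/

section Tensor

variable (R : Type u) [Ring R]

/-- The relations `x r ⊗ y = x ⊗ r y` defining `X ⊗_R Y` as a quotient of `X ⊗_ℤ Y`. A right
`R`-module is a module over `Rᵐᵒᵖ`, with `x r = op r • x`. -/
def balancedRelations (X : Type u) [AddCommGroup X] [Module Rᵐᵒᵖ X]
    (Y : Type u) [AddCommGroup Y] [Module R Y] : AddSubgroup (X ⊗[ℤ] Y) :=
  AddSubgroup.closure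
    {t | ∃ (x : X) (r : R) (y : Y), t = (op r • x) ⊗ₜ[ℤ] y - x ⊗ₜ[ℤ] (r • y)}

/-- The abelian group `X ⊗_R Y`, for a right `R`-module `X` and a left `R`-module `Y`. -/
abbrev BalancedTensor (X : Type u) [AddCommGroup X] [Module Rᵐᵒᵖ X]
    (Y : Type u) [AddCommGroup Y] [Module R Y] : Type u :=
  (X ⊗[ℤ] Y) ⧸ balancedRelations R X Y

variable {R}

/-- The pure tensor `x ⊗ y` in `X ⊗_R Y`. -/
def btmul {X : Type u} [AddCommGroup X] [Module Rᵐᵒᵖ X]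
    {Y : Type u} [AddCommGroup Y] [Module R Y] (x : X) (y : Y) : BalancedTensor R X Y :=
  QuotientAddGroup.mk (x ⊗ₜ[ℤ] y)

theorem btmul_balanced {X : Type u} [AddCommGroup X] [Module Rᵐᵒᵖ X]
    {Y : Type u} [AddCommGroup Y] [Module R Y] (x : X) (r : R) (y : Y) :
    (btmul (op r • x) y : BalancedTensor R X Y) = btmul x (r • y) := by
  refine QuotientAddGroup.eq_iff_sub_mem.2 (AddSubgroup.subset_closure ⟨x, r, y, rfl⟩)

theorem btmul_add {X : Type u} [AddCommGroup X] [Module Rᵐᵒᵖ X]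
    {Y : Type u} [AddCommGroup Y] [Module R Y] (x : X) (y y' : Y) :
    (btmul x (y + y') : BalancedTensor R X Y) = btmul x y + btmul x y' :=
  congrArg QuotientAddGroup.mk (TensorProduct.tmul_add x y y')

/-- The map `X ⊗_R Y → X ⊗_R Y'`, `x ⊗ y ↦ x ⊗ f y`. -/
def BalancedTensor.map (X : Type u) [AddCommGroup X] [Module Rᵐᵒᵖ X]
    {Y Y' : Type u} [AddCommGroup Y] [Module R Y] [AddCommGroup Y'] [Module R Y']
    (f : Y →ₗ[R] Y') : BalancedTensor R X Y →+ BalancedTensor R X Y' :=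
  QuotientAddGroup.map _ _ (LinearMap.lTensor X f.toAddMonoidHom.toIntLinearMap).toAddMonoidHom (by
    rw [balancedRelations, AddSubgroup.closure_le]
    rintro _ ⟨x, r, y, rfl⟩
    refine AddSubgroup.subset_closure ⟨x, r, f y, ?_⟩
    simp)

@[simp]
theorem BalancedTensor.map_btmul (X : Type u) [AddCommGroup X] [Module Rᵐᵒᵖ X]
    {Y Y' : Type u} [AddCommGroup Y] [Module R Y] [AddCommGroup Y'] [Module R Y']
    (f : Y →ₗ[R] Y') (x : X) (y : Y) :
    BalancedTensor.map X f (btmul x y) = btmul x (f y) :=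
  rfl

theorem BalancedTensor.hom_ext {X : Type u} [AddCommGroup X] [Module Rᵐᵒᵖ X]
    {Y : Type u} [AddCommGroup Y] [Module R Y] {G : Type u} [AddCommGroup G]
    {f g : BalancedTensor R X Y →+ G} (h : ∀ x y, f (btmul x y) = g (btmul x y)) : f = g := by
  ext t
  change f (QuotientAddGroup.mk t) = g (QuotientAddGroup.mk t)
  induction t with
  | zero => exact (map_zero f).trans (map_zero g).symm
  | tmul x y => exact h x y
  | add s t hs ht =>
    rw [QuotientAddGroup.mk_add, map_add, map_add, hs, ht]

/-- The functor `X ⊗_R -` from left `R`-modules to abelian groups. -/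
def tensorFunctor (X : ModuleCat.{u} Rᵐᵒᵖ) : ModuleCat.{u} R ⥤ AddCommGrpCat.{u} where
  obj Y := AddCommGrpCat.of (BalancedTensor R X Y)
  map f := AddCommGrpCat.ofHom (BalancedTensor.map X f.hom)
  map_id _ := AddCommGrpCat.hom_ext (BalancedTensor.hom_ext fun _ _ => rfl)
  map_comp _ _ := AddCommGrpCat.hom_ext (BalancedTensor.hom_ext fun _ _ => rfl)

instance (X : ModuleCat.{u} Rᵐᵒᵖ) : (tensorFunctor X).Additive where
  map_add {_ _ f g} := AddCommGrpCat.hom_ext (BalancedTensor.hom_ext fun x y =>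
    btmul_add x (f.hom y) (g.hom y))

/-- Left derived functors are additive. -/
theorem leftDerived_additive (F : ModuleCat.{u} R ⥤ AddCommGrpCat.{u}) [F.Additive] (i : ℕ) :
    (F.leftDerived i).Additive where
  map_add {X Y f g} := by
    have hf := ProjectiveResolution.lift_commutes f (projectiveResolution X) (projectiveResolution Y)
    have hg := ProjectiveResolution.lift_commutes g (projectiveResolution X) (projectiveResolution Y)
    rw [F.leftDerived_map_eq i f _ hf, F.leftDerived_map_eq i g _ hg,
      F.leftDerived_map_eq i (f + g)
        (ProjectiveResolution.lift f (projectiveResolution X) (projectiveResolution Y) +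
          ProjectiveResolution.lift g (projectiveResolution X) (projectiveResolution Y))
        (by rw [Preadditive.add_comp, hf, hg, Functor.map_add, Preadditive.comp_add]),
      Functor.map_add, Preadditive.add_comp, Preadditive.comp_add]

/-- The functor `Tor_i^R(X, -)`, the `i`-th left derived functor of `X ⊗_R -`. -/
def torFunctor (X : ModuleCat.{u} Rᵐᵒᵖ) (i : ℕ) : ModuleCat.{u} R ⥤ AddCommGrpCat.{u} :=
  (tensorFunctor X).leftDerived i

instance (X : ModuleCat.{u} Rᵐᵒᵖ) (i : ℕ) : (torFunctor X i).Additive :=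
  leftDerived_additive _ i

/-- A left module is perfect if it has a projective resolution of finite length all of whose terms
are finitely generated. -/
def IsPerfect (M : ModuleCat.{u} R) : Prop :=
  ∃ P : ProjectiveResolution M, (∀ n, Module.Finite R (P.complex.X n)) ∧
    ∃ N : ℕ, ∀ n, N < n → Limits.IsZero (P.complex.X n)

end Tensor

/-! ### Extending functors to bimodules -/

section RightAction

variable {k : Type v} [Field k] {R : Type u} [Ring R] [Algebra k R] {C : Type u} [Ring C]
  [Algebra k C]

/-- The left `R`-module underlying an `(R, C)`-bimodule. Here `(R, C)`-bimodules on which the two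
actions of `k` agree are left modules over `R ⊗[k] Cᵐᵒᵖ`, with `r m c = (r ⊗ op c) • m`. -/
def forgetRight (k : Type v) [Field k] (R : Type u) [Ring R] [Algebra k R] (C : Type u) [Ring C]
    [Algebra k C] : ModuleCat.{u} (R ⊗[k] Cᵐᵒᵖ) ⥤ ModuleCat.{u} R :=
  ModuleCat.restrictScalars
    (Algebra.TensorProduct.includeLeft : R →ₐ[k] R ⊗[k] Cᵐᵒᵖ).toRingHom

theorem smul_smul_swap (M : ModuleCat.{u} (R ⊗[k] Cᵐᵒᵖ)) (r : R) (c : Cᵐᵒᵖ) (m : M) :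
    (1 : R) ⊗ₜ[k] c • (r ⊗ₜ[k] (1 : Cᵐᵒᵖ) • m) = r ⊗ₜ[k] (1 : Cᵐᵒᵖ) • ((1 : R) ⊗ₜ[k] c • m) := by
  simp [smul_smul]

theorem mul_smul_right (M : ModuleCat.{u} (R ⊗[k] Cᵐᵒᵖ)) (c d : Cᵐᵒᵖ) (m : M) :
    (1 : R) ⊗ₜ[k] (c * d) • m = (1 : R) ⊗ₜ[k] c • ((1 : R) ⊗ₜ[k] d • m) := by
  simp [smul_smul]

theorem add_smul_right (M : ModuleCat.{u} (R ⊗[k] Cᵐᵒᵖ)) (c d : Cᵐᵒᵖ) (m : M) :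
    (1 : R) ⊗ₜ[k] (c + d) • m = (1 : R) ⊗ₜ[k] c • m + (1 : R) ⊗ₜ[k] d • m := by
  rw [TensorProduct.tmul_add, add_smul]

/-- The action of `c : Cᵐᵒᵖ` on an `(R, C)`-bimodule, as an endomorphism of the underlying left
`R`-module. -/
def rightMul (M : ModuleCat.{u} (R ⊗[k] Cᵐᵒᵖ)) (c : Cᵐᵒᵖ) :
    (forgetRight k R C).obj M ⟶ (forgetRight k R C).obj M :=
  ModuleCat.ofHom (X := (forgetRight k R C).obj M) (Y := (forgetRight k R C).obj M)
    { toFun := fun m : M => (1 : R) ⊗ₜ[k] c • m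
      map_add' := fun x y : M => smul_add ((1 : R) ⊗ₜ[k] c) x y
      map_smul' := fun r x => smul_smul_swap M r c x }

theorem rightMul_one (M : ModuleCat.{u} (R ⊗[k] Cᵐᵒᵖ)) : rightMul M 1 = 𝟙 _ := by
  ext m
  exact one_smul (R ⊗[k] Cᵐᵒᵖ) (α := M) m

theorem rightMul_mul (M : ModuleCat.{u} (R ⊗[k] Cᵐᵒᵖ)) (c d : Cᵐᵒᵖ) :
    rightMul M (c * d) = rightMul M d ≫ rightMul M c := by
  ext m
  exact mul_smul_right M c d m

theorem rightMul_add (M : ModuleCat.{u} (R ⊗[k] Cᵐᵒᵖ)) (c d : Cᵐᵒᵖ) :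
    rightMul M (c + d) = rightMul M c + rightMul M d := by
  ext m
  exact add_smul_right M c d m

theorem rightMul_naturality {M N : ModuleCat.{u} (R ⊗[k] Cᵐᵒᵖ)} (f : M ⟶ N) (c : Cᵐᵒᵖ) :
    rightMul M c ≫ (forgetRight k R C).map f = (forgetRight k R C).map f ≫ rightMul N c := by
  ext m
  exact f.hom.map_smul ((1 : R) ⊗ₜ[k] c) m

/-- For an additive functor `F` on left `R`-modules and an `(R, C)`-bimodule `M`, the right
`C`-module structure on `F(M)` in which `c` acts by `F` applied to the right multiplication by `c`. -/
abbrev rightModule (F : ModuleCat.{u} R ⥤ AddCommGrpCat.{u}) [F.Additive]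
    (M : ModuleCat.{u} (R ⊗[k] Cᵐᵒᵖ)) : Module Cᵐᵒᵖ (F.obj ((forgetRight k R C).obj M)) where
  smul c x := (F.map (rightMul M c)).hom x
  one_smul x := by
    change (F.map (rightMul M 1)).hom x = x
    rw [rightMul_one, F.map_id]; rfl
  mul_smul c d x := by
    change (F.map (rightMul M (c * d))).hom x =
      (F.map (rightMul M c)).hom ((F.map (rightMul M d)).hom x)
    rw [rightMul_mul, F.map_comp]; rfl
  smul_zero c := map_zero (F.map (rightMul M c)).hom
  smul_add c := map_add (F.map (rightMul M c)).hom
  add_smul c d x := by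
    change (F.map (rightMul M (c + d))).hom x =
      (F.map (rightMul M c)).hom x + (F.map (rightMul M d)).hom x
    rw [rightMul_add, F.map_add]; rfl
  zero_smul x := by
    have h : rightMul M (0 : Cᵐᵒᵖ) = 0 := by
      have := rightMul_add M (0 : Cᵐᵒᵖ) 0
      rw [add_zero] at this
      exact left_eq_add.1 this
    change (F.map (rightMul M 0)).hom x = 0
    rw [h, F.map_zero]; rfl

/-- The right `C`-module `F(M)`, for an `(R, C)`-bimodule `M`. -/
def rightObj (F : ModuleCat.{u} R ⥤ AddCommGrpCat.{u}) [F.Additive]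
    (M : ModuleCat.{u} (R ⊗[k] Cᵐᵒᵖ)) : ModuleCat.{u} Cᵐᵒᵖ :=
  letI := rightModule F M
  ModuleCat.of Cᵐᵒᵖ (F.obj ((forgetRight k R C).obj M))

/-- The `C`-linear map `F(M) → F(N)` induced by a map `f : M → N` of `(R, C)`-bimodules. -/
def rightMap (F : ModuleCat.{u} R ⥤ AddCommGrpCat.{u}) [F.Additive]
    {M N : ModuleCat.{u} (R ⊗[k] Cᵐᵒᵖ)} (f : M ⟶ N) : rightObj F M ⟶ rightObj F N :=
  ModuleCat.ofHom (X := rightObj F M) (Y := rightObj F N)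
    { toFun := (F.map ((forgetRight k R C).map f)).hom
      map_add' := map_add (F.map ((forgetRight k R C).map f)).hom
      map_smul' := fun c x => by
        change (F.map ((forgetRight k R C).map f)).hom ((F.map (rightMul M c)).hom x) =
          (F.map (rightMul N c)).hom ((F.map ((forgetRight k R C).map f)).hom x)
        have h := congrArg F.map (rightMul_naturality f c)
        rw [F.map_comp, F.map_comp] at h
        exact ConcreteCategory.congr_hom h x }

/-- An additive functor `F` from left `R`-modules to abelian groups, seen as a functor from
`(R, C)`-bimodules to right `C`-modules. -/
def onBimodules (F : ModuleCat.{u} R ⥤ AddCommGrpCat.{u}) [F.Additive] :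
    ModuleCat.{u} (R ⊗[k] Cᵐᵒᵖ) ⥤ ModuleCat.{u} Cᵐᵒᵖ where
  obj M := rightObj F M
  map f := rightMap F f
  map_id M := by
    have h : F.map ((forgetRight k R C).map (𝟙 M)) = 𝟙 _ := by
      rw [CategoryTheory.Functor.map_id, CategoryTheory.Functor.map_id]
    exact ModuleCat.hom_ext (LinearMap.ext fun x => ConcreteCategory.congr_hom h x)
  map_comp f g := by
    have h : F.map ((forgetRight k R C).map (f ≫ g)) =
        F.map ((forgetRight k R C).map f) ≫ F.map ((forgetRight k R C).map g) := by
      rw [CategoryTheory.Functor.map_comp, CategoryTheory.Functor.map_comp]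
    exact ModuleCat.hom_ext (LinearMap.ext fun x => ConcreteCategory.congr_hom h x)

end RightAction

/-! ### Bimodules over an algebra -/

section Algebra

variable (k : Type v) [Field k] (A : Type u) [Ring A] [Algebra k A]

/-- The enveloping algebra `A^e = A ⊗_k A^op`. A (`k`-central) `(A, A)`-bimodule is the same thing
as a left `A^e`-module, with `a m b = (a ⊗ op b) • m`. -/
abbrev Env : Type u := A ⊗[k] Aᵐᵒᵖ

/-- `A` as an `(A, A)`-bimodule, `(a ⊗ op b) • m = a * m * b`. -/
def regularBimodule : ModuleCat.{u} (Env k A) :=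
  letI : Module (Env k A) A := instModuleTensorProductMop k A
  ModuleCat.of (Env k A) A

theorem regularBimodule_smul (a b m : A) :
    HSMul.hSMul (β := regularBimodule k A) (γ := regularBimodule k A)
      (a ⊗ₜ[k] op b : Env k A) m = a * m * b := by
  change AlgHom.mulLeftRight k A (a ⊗ₜ[k] op b) m = a * m * b
  simp

/-- The isomorphism `(A^e)^op ≅ A^e`, `op (b ⊗ op a) ↦ a ⊗ op b`. -/
def envOp : (Env k A)ᵐᵒᵖ ≃ₐ[k] Env k A :=
  (Algebra.TensorProduct.opAlgEquiv k k A Aᵐᵒᵖ).symm.trans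
    ((Algebra.TensorProduct.comm k Aᵐᵒᵖ Aᵐᵒᵖᵐᵒᵖ).trans
      (Algebra.TensorProduct.congr (AlgEquiv.opOp k A).symm AlgEquiv.refl))

@[simp]
theorem envOp_tmul (a b : A) : envOp k A (op (b ⊗ₜ[k] op a)) = a ⊗ₜ[k] op b := by
  simp [envOp]

/-- An `(A, A)`-bimodule as a right `A^e`-module, `m (b ⊗ op a) = a m b`. -/
def toRightEnv : ModuleCat.{u} (Env k A) ⥤ ModuleCat.{u} (Env k A)ᵐᵒᵖ :=
  ModuleCat.restrictScalars (envOp k A).toRingEquiv.toRingHom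

/-- The left `A`-module underlying an `(A, A)`-bimodule. -/
def leftPart : ModuleCat.{u} (Env k A) ⥤ ModuleCat.{u} A :=
  ModuleCat.restrictScalars (Algebra.TensorProduct.includeLeft : A →ₐ[k] Env k A).toRingHom

/-- The right `A`-module underlying an `(A, A)`-bimodule. -/
def rightPart : ModuleCat.{u} (Env k A) ⥤ ModuleCat.{u} Aᵐᵒᵖ :=
  ModuleCat.restrictScalars (Algebra.TensorProduct.includeRight : Aᵐᵒᵖ →ₐ[k] Env k A).toRingHom

variable {A}

/-- `U ⊗_A V ≅ A` as `(A, A)`-bimodules, where `a (u ⊗ v) b = (a u) ⊗ (v b)` on the left. -/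
def TensorIsoRegular (U V : ModuleCat.{u} (Env k A)) : Prop :=
  ∃ e : BalancedTensor A ((rightPart k A).obj U) ((leftPart k A).obj V) ≃+ A,
    ∀ (a b : A) (u : U) (v : V),
      e (btmul (X := (rightPart k A).obj U) (Y := (leftPart k A).obj V)
          (a ⊗ₜ[k] (1 : Aᵐᵒᵖ) • u : U) ((1 : A) ⊗ₜ[k] op b • v : V)) =
        a * e (btmul (X := (rightPart k A).obj U) (Y := (leftPart k A).obj V) u v) * b

/-- A bimodule `U` is invertible if `U ⊗_A V ≅ A ≅ V ⊗_A U` as bimodules for some bimodule `V`. -/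
def IsInvertible (U : ModuleCat.{u} (Env k A)) : Prop :=
  ∃ V : ModuleCat.{u} (Env k A), TensorIsoRegular k U V ∧ TensorIsoRegular k V U

variable (A)

/-- `A` is homologically smooth if it is perfect as a left `A^e`-module. -/
def HomologicallySmooth : Prop := IsPerfect (regularBimodule k A)

/-- The functor `Ext^i_{A^e}(A, -)` on left `A^e`-modules. -/
abbrev extFromRegular (i : ℕ) : ModuleCat.{u} (Env k A) ⥤ AddCommGrpCat.{u} :=
  Abelian.extFunctorObj (regularBimodule k A) i

/-- `Ext^i_{A^e}(A, A^e)` as a right `A^e`-module, via the right `A^e`-module structure of the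
`(A^e, A^e)`-bimodule `A^e`. -/
def extEnv (i : ℕ) : ModuleCat.{u} (Env k A)ᵐᵒᵖ :=
  (onBimodules (k := k) (C := Env k A) (extFromRegular k A i)).obj (regularBimodule k (Env k A))

/-- `A` is twisted Calabi-Yau of dimension `d` with Nakayama bimodule `U`: it is homologically
smooth, `U` is invertible, `Ext^i_{A^e}(A, A^e) = 0` for `i ≠ d`, and
`Ext^d_{A^e}(A, A^e) ≅ U` as bimodules (that is, as right `A^e`-modules). -/
structure IsTwistedCYWith (d : ℕ) (U : ModuleCat.{u} (Env k A)) : Prop where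
  smooth : HomologicallySmooth k A
  invertible : IsInvertible k U
  ext_eq_zero : ∀ i : ℕ, i ≠ d → Limits.IsZero (extEnv k A i)
  ext_iso : Nonempty (extEnv k A d ≅ (toRightEnv k A).obj U)

/-- `A` is twisted Calabi-Yau of dimension `d`. -/
def IsTwistedCY (d : ℕ) : Prop := ∃ U : ModuleCat.{u} (Env k A), IsTwistedCYWith k A d U

end Algebra

end TwistedCY

end

/-!
Write `A^e` for the enveloping algebra.

The equivalence of the twisted Calabi-Yau property with the duality
`Tor_i(U, -) ≅ Ext^{d-i}(A, -)` goes through a criterion on functors of left `A^e`-modules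
(`isTwistedCYWith_iff`): for homologically smooth `A` and invertible `U`, the property says that
`Ext^i(A, A^e) = 0` for `i ≠ d` and that `Ext^d(A, -) ≅ U ⊗_{A^e} -`. Indeed, a finitely generated
projective resolution makes the functors `Ext^i(A, -)` finitary on free modules
(`finitaryOnFree_ext`), so they vanish on all projectives as soon as they vanish on `A^e`; the
resolution being finite, `Ext^i(A, -)` is then zero for `i > d`, so `Ext^d(A, -)` is right exact,
and by the theorem of Eilenberg and Watts it is the tensor product with its value at `A^e`
(`FinitaryOnFree.wattsIso`). Shifting dimensions along a functorial presentation
`0 → syz M → F M → M → 0` identifies `Ext^{d-i}(A, -)` with the `i`-th left derived functor of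
`Ext^d(A, -)` (`FunctorialPresentation.leftDerived_ext_iso`), which is `Tor_i(U, -)`. Conversely,
`Tor_{d-i}(U, -)` vanishes on projectives for `i < d`, and `Ext^d(A, -) ≅ U ⊗_{A^e} -` preserves
epimorphisms, which forces `Ext^i(A, -) = 0` for `i > d`. A natural isomorphism of functors on
left modules is automatically compatible with any additional right action, and it can be recovered
from the isomorphisms on bimodules by taking for `C` the centre of `A^e`
(`iso_of_onBimodules_iso`).

For Morita invariance, let `Q` be the `A`-module that corresponds to the `B`-module `B`. The
modules `A` and `Q` are both separators, so by a trace ideal argument the identity of `W = A ⊕ Q`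
is a finite sum of maps that factor through either of them. Hence `A` and `B` are both full
corners `ε L ε`, `L ε L = L`, of the algebra `L = (End W)ᵒᵖ`, and it suffices to compare an
algebra with its full corners (`FullCorner.isTwistedCY_iff`). If `S` is a full corner of `R`, then
`M ↦ ε M` is an equivalence from left `R`-modules to left `S`-modules which respects finite
generation and turns tensor products over `R` into tensor products over `S`. Applied to the full
corner `A^e` of `L^e`, this sends the bimodule `L` to `A`, and it is compatible with perfect
modules, Ext, tensor products of bimodules, and therefore with every ingredient of the criterion.
-/

noncomputable section

namespace TwistedCY

/-! ### Functors on free modules -/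

section Finitary

variable (k : Type v) [Field k] (R : Type u) [Ring R] [Algebra k R]

/-- The ring `R` as a left module over itself, presented as the left module underlying the regular
`(R, R)`-bimodule, so that it comes with its right multiplications `rightMul`. -/
abbrev regularLeft : ModuleCat.{u} R := (forgetRight k R R).obj (regularBimodule k R)

variable {R}

/-- The identification of the ring `R` with the module `regularLeft k R`. -/
def regEquiv : R ≃+ regularLeft k R := AddEquiv.refl R

theorem smul_regEquiv (r x : R) : r • regEquiv k x = regEquiv k (r * x) := by
  refine (regularBimodule_smul k R r 1 x).trans ?_
  rw [mul_one]; rfl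

theorem regEquiv_symm_smul (r : R) (x : regularLeft k R) :
    (regEquiv k).symm (r • x) = r * (regEquiv k).symm x := by
  rw [AddEquiv.symm_apply_eq, ← smul_regEquiv, AddEquiv.apply_symm_apply]

theorem regularLeft_hom_ext {M : ModuleCat.{u} R} {f g : regularLeft k R ⟶ M}
    (h : ∀ r : R, f.hom (regEquiv k r) = g.hom (regEquiv k r)) : f = g :=
  ModuleCat.hom_ext (LinearMap.ext fun x => by
    simpa using h ((regEquiv k).symm x))

/-- The map `R → M`, `r ↦ r m`. -/
def ofElement {M : ModuleCat.{u} R} (m : M) : regularLeft k R ⟶ M :=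
  ModuleCat.ofHom (X := regularLeft k R)
    { toFun := fun x => (regEquiv k).symm x • m
      map_add' := fun r s => by rw [map_add, add_smul]
      map_smul' := fun r s =>
        (congrArg (· • m) (regEquiv_symm_smul k r s)).trans (mul_smul r ((regEquiv k).symm s) m) }

@[simp]
theorem ofElement_apply {M : ModuleCat.{u} R} (m : M) (r : R) :
    (ofElement k m).hom (regEquiv k r) = r • m := rfl

theorem ofElement_comp {M N : ModuleCat.{u} R} (m : M) (f : M ⟶ N) :
    ofElement k m ≫ f = ofElement k (f.hom m) :=
  regularLeft_hom_ext k fun r => f.hom.map_smul r m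

theorem ofElement_add {M : ModuleCat.{u} R} (m n : M) :
    ofElement k (m + n) = ofElement k m + ofElement k n :=
  regularLeft_hom_ext k fun r => smul_add r m n

theorem rightMul_regular_apply (c x : R) :
    (rightMul (regularBimodule k R) (op c)).hom (regEquiv k x) = regEquiv k (x * c) := by
  refine (regularBimodule_smul k R 1 c x).trans ?_
  rw [one_mul]; rfl

theorem rightMul_comp_ofElement {M : ModuleCat.{u} R} (r : R) (m : M) :
    rightMul (regularBimodule k R) (op r) ≫ ofElement k m = ofElement k (r • m) :=
  regularLeft_hom_ext k fun x =>
    (congrArg (ofElement k m).hom (rightMul_regular_apply k r x)).trans (mul_smul x r m)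

/-- The coordinate projection `R^(S) → R` at `s`. -/
def freeProj (S : Type u) (s : S) : ModuleCat.of R (S →₀ R) ⟶ regularLeft k R :=
  ModuleCat.ofHom (Y := regularLeft k R)
    { toFun := fun f => regEquiv k (f s)
      map_add' := fun _ _ => rfl
      map_smul' := fun r f => (smul_regEquiv k r (f s)).symm }

theorem freeProj_apply (S : Type u) (s : S) (f : S →₀ R) :
    (freeProj k S s).hom f = regEquiv k (f s) := rfl

/-- The coordinate inclusion `R → R^(S)` at `s`. -/
def freeIncl (S : Type u) (s : S) : regularLeft k R ⟶ ModuleCat.of R (S →₀ R) :=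
  ofElement k (M := ModuleCat.of R (S →₀ R)) (Finsupp.single s (1 : R))

theorem freeIncl_apply (S : Type u) (s : S) (r : R) :
    (freeIncl k S s).hom (regEquiv k r) = Finsupp.single s r :=
  (Finsupp.smul_single r s (1 : R)).trans (by simp)

theorem freeIncl_comp_freeProj_self (S : Type u) (s : S) :
    freeIncl k S s ≫ freeProj (R := R) k S s = 𝟙 _ :=
  regularLeft_hom_ext k fun r => by
    change (freeProj k S s).hom ((freeIncl k S s).hom _) = regEquiv k r
    rw [freeIncl_apply, freeProj_apply, Finsupp.single_eq_same]

theorem freeIncl_comp_freeProj_of_ne (S : Type u) {s t : S} (h : s ≠ t) :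
    freeIncl k S s ≫ freeProj (R := R) k S t = 0 :=
  regularLeft_hom_ext k fun r => by
    change (freeProj k S t).hom ((freeIncl k S s).hom _) = 0
    rw [freeIncl_apply, freeProj_apply, Finsupp.single_eq_of_ne h.symm, map_zero]

/-- The idempotent endomorphism of `R^(S)` that keeps the coordinates in the finite set `T`. -/
def freeCut (S : Type u) (T : Finset S) :
    ModuleCat.of R (S →₀ R) ⟶ ModuleCat.of R (S →₀ R) :=
  ∑ s ∈ T, freeProj k S s ≫ freeIncl k S s

theorem freeCut_apply (S : Type u) (T : Finset S) (f : S →₀ R) :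
    (freeCut k S T).hom f = ∑ s ∈ T, Finsupp.single s (f s) := by
  rw [freeCut, ModuleCat.hom_sum, LinearMap.sum_apply]
  refine Finset.sum_congr rfl fun s _ => ?_
  exact freeIncl_apply k S s (f s)

theorem freeCut_eq_self (S : Type u) {T : Finset S} {f : S →₀ R} (h : f.support ⊆ T) :
    (freeCut k S T).hom f = f := by
  rw [freeCut_apply]
  conv_rhs => rw [← Finsupp.sum_single f]
  exact (Finsupp.sum_of_support_subset f h _ (fun s _ => Finsupp.single_zero s)).symm

/-- A functor on left `R`-modules is finitary on free modules if every element of its value at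
`R^(S)` is supported on finitely many coordinates. -/
def FinitaryOnFree (G : ModuleCat.{u} R ⥤ AddCommGrpCat.{u}) : Prop :=
  ∀ (S : Type u) (x : G.obj (ModuleCat.of R (S →₀ R))), ∃ T : Finset S,
    (G.map (freeCut k S T)).hom x = x

variable {k} in
theorem FinitaryOnFree.exists_sum {G : ModuleCat.{u} R ⥤ AddCommGrpCat.{u}} [G.Additive]
    (hG : FinitaryOnFree k G) (S : Type u) (x : G.obj (ModuleCat.of R (S →₀ R))) :
    ∃ T : Finset S,
      x = ∑ s ∈ T, (G.map (freeIncl k S s)).hom ((G.map (freeProj k S s)).hom x) := by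
  obtain ⟨T, hT⟩ := hG S x
  refine ⟨T, ?_⟩
  conv_lhs => rw [← hT]
  rw [freeCut]
  refine (map_sum (AddMonoidHom.mk' (fun φ : ModuleCat.of R (S →₀ R) ⟶ ModuleCat.of R (S →₀ R) =>
    (G.map φ).hom x) fun φ ψ => by rw [G.map_add]; rfl) _ T).trans ?_
  refine Finset.sum_congr rfl fun s _ => ?_
  change (G.map (freeProj k S s ≫ freeIncl k S s)).hom x = _
  rw [G.map_comp]
  rfl

variable {k} in
theorem FinitaryOnFree.subsingleton {G : ModuleCat.{u} R ⥤ AddCommGrpCat.{u}} [G.Additive]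
    (hG : FinitaryOnFree k G) [Subsingleton (G.obj (regularLeft k R))] (S : Type u) :
    Subsingleton (G.obj (ModuleCat.of R (S →₀ R))) := by
  refine subsingleton_of_forall_eq 0 fun x => ?_
  obtain ⟨T, hT⟩ := hG.exists_sum S x
  rw [hT]
  refine Finset.sum_eq_zero fun s _ => ?_
  rw [Subsingleton.elim ((G.map (freeProj k S s)).hom x) 0, map_zero]

/-- Since a map from a finitely generated module to `R^(S)` only meets finitely many coordinates,
`Ext^i(X, -)` is finitary on free modules as soon as `X` has a projective resolution that is
finitely generated in degree `i`. -/
theorem finitaryOnFree_ext {X : ModuleCat.{u} R} (P : ProjectiveResolution X) (i : ℕ)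
    [Module.Finite R (P.complex.X i)] :
    FinitaryOnFree k (Abelian.extFunctorObj X i) := by
  classical
  intro S x
  obtain ⟨f, hf, rfl⟩ := P.extMk_surjective x (i + 1) rfl
  obtain ⟨s, hs⟩ := Module.Finite.fg_top (R := R) (M := P.complex.X i)
  let T : Finset S := s.biUnion fun p => (show S →₀ R from f.hom p).support
  refine ⟨T, ?_⟩
  have key : f ≫ freeCut k S T = f := by
    refine ModuleCat.hom_ext (LinearMap.ext_on hs fun p hp => ?_)
    refine freeCut_eq_self k S ?_
    exact Finset.subset_biUnion_of_mem (fun p => (show S →₀ R from f.hom p).support) hp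
  refine (P.extMk_comp_mk₀ f (i + 1) rfl hf (freeCut k S T)).trans ?_
  congr 1

theorem exists_epi_free (M : ModuleCat.{u} R) : ∃ (S : Type u)
    (p : ModuleCat.of R (S →₀ R) ⟶ M), Epi p := by
  refine ⟨M, ModuleCat.ofHom (Finsupp.linearCombination R id), ?_⟩
  rw [ModuleCat.epi_iff_surjective]
  exact Finsupp.linearCombination_id_surjective R M

variable {k} in
/-- A finitary functor that vanishes at `R` vanishes at every projective module. -/
theorem FinitaryOnFree.subsingleton_of_projective {G : ModuleCat.{u} R ⥤ AddCommGrpCat.{u}}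
    [G.Additive] (hG : FinitaryOnFree k G) [Subsingleton (G.obj (regularLeft k R))]
    (Q : ModuleCat.{u} R) [Projective Q] : Subsingleton (G.obj Q) := by
  obtain ⟨S, p, hp⟩ := exists_epi_free Q
  have := hG.subsingleton S
  refine subsingleton_of_forall_eq 0 fun x => ?_
  have h : (G.map (𝟙 Q)).hom x = x := by rw [G.map_id]; rfl
  rw [← Projective.factorThru_comp (𝟙 Q) p, G.map_comp] at h
  rw [← h]
  change (G.map p).hom ((G.map (Projective.factorThru (𝟙 Q) p)).hom x) = 0
  rw [Subsingleton.elim ((G.map (Projective.factorThru (𝟙 Q) p)).hom x) 0, map_zero]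

end Finitary

/-! ### Right exact functors are tensor products -/

section BalancedTensorLift

variable {R : Type u} [Ring R] {X : Type u} [AddCommGroup X] [Module Rᵐᵒᵖ X]
  {Y : Type u} [AddCommGroup Y] [Module R Y] {Z : Type*} [AddCommGroup Z]

/-- The additive map out of `X ⊗_R Y` given by an `R`-balanced biadditive map. -/
def BalancedTensor.lift (f : X →+ Y →+ Z) (h : ∀ x (r : R) y, f (op r • x) y = f x (r • y)) :
    BalancedTensor R X Y →+ Z :=
  QuotientAddGroup.lift _ (TensorProduct.liftAddHom f fun n x y => by
    rw [map_zsmul, AddMonoidHom.zsmul_apply, map_zsmul]) (by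
    rw [balancedRelations, AddSubgroup.closure_le]
    rintro _ ⟨x, r, y, rfl⟩
    simp [h])

theorem add_btmul (x x' : X) (y : Y) :
    (btmul (x + x') y : BalancedTensor R X Y) = btmul x y + btmul x' y :=
  congrArg QuotientAddGroup.mk (TensorProduct.add_tmul x x' y)

theorem btmul_zero (x : X) : (btmul x (0 : Y) : BalancedTensor R X Y) = 0 :=
  congrArg QuotientAddGroup.mk (TensorProduct.tmul_zero Y x)

theorem zero_btmul (y : Y) : (btmul (0 : X) y : BalancedTensor R X Y) = 0 :=
  congrArg QuotientAddGroup.mk (TensorProduct.zero_tmul X y)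

/-- The biadditive map `(x, y) ↦ x ⊗ y`. -/
def btmulHom : X →+ Y →+ BalancedTensor R X Y :=
  AddMonoidHom.mk' (fun x => AddMonoidHom.mk' (fun y => btmul x y) (btmul_add x))
    fun x x' => AddMonoidHom.ext fun y => add_btmul x x' y

@[elab_as_elim]
theorem BalancedTensor.induction {p : BalancedTensor R X Y → Prop} (t : BalancedTensor R X Y)
    (zero : p 0) (tmul : ∀ x y, p (btmul x y)) (add : ∀ s t, p s → p t → p (s + t)) : p t := by
  induction t using QuotientAddGroup.induction_on with
  | H t =>
    induction t with
    | zero => exact zero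
    | tmul x y => exact tmul x y
    | add s t hs ht => exact add _ _ hs ht

theorem BalancedTensor.map_surjective (X : Type u) [AddCommGroup X] [Module Rᵐᵒᵖ X]
    {Y' : Type u} [AddCommGroup Y'] [Module R Y'] {f : Y →ₗ[R] Y'} (hf : Function.Surjective f) :
    Function.Surjective (BalancedTensor.map X f) := by
  intro t
  induction t using BalancedTensor.induction with
  | zero => exact ⟨0, map_zero _⟩
  | tmul x y =>
    obtain ⟨y, rfl⟩ := hf y
    exact ⟨btmul x y, rfl⟩
  | add s t hs ht =>
    obtain ⟨s, rfl⟩ := hs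
    obtain ⟨t, rfl⟩ := ht
    exact ⟨s + t, map_add _ _ _⟩

end BalancedTensorLift

section Watts

variable (k : Type v) [Field k] {R : Type u} [Ring R] [Algebra k R]
  (G : ModuleCat.{u} R ⥤ AddCommGrpCat.{u}) [G.Additive]

/-- The right `R`-module `G(R)`. -/
abbrev valueAtRegular : ModuleCat.{u} Rᵐᵒᵖ := rightObj G (regularBimodule k R)

/-- The natural map `G(R) ⊗_R M → G(M)`, `x ⊗ m ↦ G(r ↦ r m)(x)`. -/
def wattsMap (M : ModuleCat.{u} R) : BalancedTensor R (valueAtRegular k G) M →+ G.obj M :=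
  BalancedTensor.lift (X := valueAtRegular k G)
    (AddMonoidHom.mk' (fun x : G.obj (regularLeft k R) =>
        AddMonoidHom.mk' (fun m : M => (G.map (ofElement k m)).hom x) fun m n => by
          rw [ofElement_add, G.map_add]; rfl)
      fun x y => AddMonoidHom.ext fun m => map_add (G.map (ofElement k m)).hom x y)
    fun x r m => by
      change (G.map (ofElement k m)).hom ((G.map (rightMul _ (op r))).hom x) =
        (G.map (ofElement k (r • m))).hom x
      rw [← rightMul_comp_ofElement, G.map_comp]
      rfl

/-- The maps `G(R) ⊗_R M → G(M)`, as a natural transformation. -/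
def wattsTrans : tensorFunctor (valueAtRegular k G) ⟶ G where
  app M := AddCommGrpCat.ofHom (wattsMap k G M)
  naturality M N f := AddCommGrpCat.hom_ext (BalancedTensor.hom_ext fun x m => by
    change (G.map (ofElement k (f.hom m))).hom x = (G.map f).hom ((G.map (ofElement k m)).hom x)
    rw [← ofElement_comp, G.map_comp]
    rfl)

theorem wattsMap_naturality {M N : ModuleCat.{u} R} (f : M ⟶ N)
    (t : BalancedTensor R (valueAtRegular k G) M) :
    wattsMap k G N (BalancedTensor.map _ f.hom t) = (G.map f).hom (wattsMap k G M t) :=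
  ConcreteCategory.congr_hom ((wattsTrans k G).naturality f) t

variable {G}

/-- The map `X^(S) → X ⊗_R R^(S)`, `(x_s) ↦ ∑ x_s ⊗ e_s`. -/
def tensorFreeHom (X : Type u) [AddCommGroup X] [Module Rᵐᵒᵖ X] (S : Type u) :
    (S →₀ X) →+ BalancedTensor R X (S →₀ R) :=
  Finsupp.liftAddHom fun s => (btmulHom (R := R)).flip (Finsupp.single s (1 : R))

theorem tensorFreeHom_single (X : Type u) [AddCommGroup X] [Module Rᵐᵒᵖ X] (S : Type u) (s : S)
    (x : X) : tensorFreeHom X S (Finsupp.single s x) = btmul x (Finsupp.single s (1 : R)) :=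
  Finsupp.liftAddHom_apply_single _ s x

theorem tensorFreeHom_surjective (X : Type u) [AddCommGroup X] [Module Rᵐᵒᵖ X] (S : Type u) :
    Function.Surjective (tensorFreeHom (R := R) X S) := by
  rw [← AddMonoidHom.range_eq_top, eq_top_iff]
  rintro t -
  induction t using BalancedTensor.induction with
  | zero => exact zero_mem _
  | tmul x f =>
    induction f using Finsupp.induction_linear with
    | zero => rw [btmul_zero]; exact zero_mem _
    | add f g hf hg => rw [btmul_add]; exact add_mem hf hg
    | single s r =>
      refine ⟨Finsupp.single s (op r • x), ?_⟩
      rw [tensorFreeHom_single, btmul_balanced, Finsupp.smul_single, smul_eq_mul, mul_one]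
  | add t t' ht ht' => exact add_mem ht ht'

theorem wattsMap_tensorFreeHom (S : Type u) (x : S →₀ valueAtRegular k G) (s : S) :
    (G.map (freeProj k S s)).hom
      (wattsMap k G (ModuleCat.of R (S →₀ R)) (tensorFreeHom (valueAtRegular k G) S x)) = x s := by
  classical
  induction x using Finsupp.induction_linear with
  | zero => rw [map_zero, map_zero, map_zero]; rfl
  | add x y hx hy => rw [map_add, map_add, map_add, hx, hy]; rfl
  | single s' x =>
    rw [tensorFreeHom_single]
    change (G.map (freeIncl k S s') ≫ G.map (freeProj k S s)).hom x = _
    rw [← G.map_comp]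
    by_cases h : s' = s
    · subst h
      rw [freeIncl_comp_freeProj_self, G.map_id, Finsupp.single_eq_same]
      rfl
    · rw [freeIncl_comp_freeProj_of_ne k S h, G.map_zero, Finsupp.single_eq_of_ne (Ne.symm h)]
      rfl

/-- `G(R) ⊗_R R^(S) → G(R^(S))` is bijective: it is injective because the coordinates of an
element of the source can be read off from its image, and surjective because `G` is finitary. -/
theorem FinitaryOnFree.wattsMap_bijective_free (hG : FinitaryOnFree k G) (S : Type u) :
    Function.Bijective (wattsMap k G (ModuleCat.of R (S →₀ R))) := by
  classical
  constructor
  · rw [injective_iff_map_eq_zero]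
    intro t ht
    obtain ⟨x, rfl⟩ := tensorFreeHom_surjective _ S t
    suffices h : x = 0 by rw [h, map_zero]
    ext s
    rw [← wattsMap_tensorFreeHom, ht, map_zero]
    rfl
  · intro y
    obtain ⟨T, hT⟩ := hG.exists_sum S y
    refine ⟨∑ s ∈ T, btmul (X := valueAtRegular k G)
      (show G.obj (regularLeft k R) from (G.map (freeProj k S s)).hom y)
      (Finsupp.single s (1 : R)), ?_⟩
    rw [map_sum]
    exact hT.symm

/-- A right exact functor that is finitary on free modules is a tensor product functor. -/
theorem FinitaryOnFree.wattsMap_bijective (hG : FinitaryOnFree k G)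
    (hex : ∀ S : ShortComplex (ModuleCat.{u} R), S.ShortExact →
      (S.map G).Exact ∧ Epi (S.map G).g) (M : ModuleCat.{u} R) :
    Function.Bijective (wattsMap k G M) := by
  have surj : ∀ M : ModuleCat.{u} R, Function.Surjective (wattsMap k G M) := by
    intro M y
    obtain ⟨S, p, hp⟩ := exists_epi_free M
    have := (hex _ { exact := ShortComplex.exact_kernel p }).2
    rw [AddCommGrpCat.epi_iff_surjective] at this
    obtain ⟨z, rfl⟩ := this y
    obtain ⟨t, rfl⟩ := (hG.wattsMap_bijective_free k S).2 z
    exact ⟨BalancedTensor.map _ p.hom t, wattsMap_naturality k G p t⟩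
  refine ⟨?_, surj M⟩
  rw [injective_iff_map_eq_zero]
  intro t ht
  obtain ⟨S, p, hp⟩ := exists_epi_free M
  obtain ⟨t, rfl⟩ := BalancedTensor.map_surjective (valueAtRegular k G)
    ((ModuleCat.epi_iff_surjective p).1 hp) t
  have h := (hex _ { exact := ShortComplex.exact_kernel p }).1
  rw [ShortComplex.ab_exact_iff] at h
  obtain ⟨y, hy⟩ := h (wattsMap k G _ t) ((wattsMap_naturality k G p t).symm.trans ht)
  obtain ⟨t', rfl⟩ := surj _ y
  have h' : t = BalancedTensor.map _ (Limits.kernel.ι p).hom t' :=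
    (hG.wattsMap_bijective_free k S).1
      (hy.symm.trans (wattsMap_naturality k G (Limits.kernel.ι p) t').symm)
  rw [h']
  have h0 := ConcreteCategory.congr_hom (congrArg (tensorFunctor (valueAtRegular k G)).map
    (Limits.kernel.condition p)) t'
  rw [Functor.map_comp, Functor.map_zero] at h0
  exact h0

/-- The isomorphism `G(R) ⊗_R - ≅ G` for a right exact functor that is finitary on free modules. -/
def FinitaryOnFree.wattsIso (hG : FinitaryOnFree k G)
    (hex : ∀ S : ShortComplex (ModuleCat.{u} R), S.ShortExact →
      (S.map G).Exact ∧ Epi (S.map G).g) : tensorFunctor (valueAtRegular k G) ≅ G :=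
  have : ∀ M, IsIso ((wattsTrans k G).app M) := fun M =>
    (ConcreteCategory.isIso_iff_bijective _).2 (hG.wattsMap_bijective k hex M)
  have := NatIso.isIso_of_isIso_app (wattsTrans k G)
  asIso (wattsTrans k G)

end Watts

/-! ### Dimension shifting for left derived functors -/

section DimensionShift

open Limits

variable {C : Type*} [Category* C] [Abelian C]

/-- The augmentation `P₀ → Z` of a projective resolution of `Z`. -/
def augmentation {Z : C} (P : ProjectiveResolution Z) : P.complex.X 0 ⟶ Z := P.π.f 0

theorem d_augmentation {Z : C} (P : ProjectiveResolution Z) :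
    P.complex.d 1 0 ≫ augmentation P = 0 := P.complex_d_comp_π_f_zero

instance {Z : C} (P : ProjectiveResolution Z) : Epi (augmentation P) :=
  inferInstanceAs (Epi (P.π.f 0))

theorem augmentation_exact {Z : C} (P : ProjectiveResolution Z) :
    (ShortComplex.mk _ _ (d_augmentation P)).Exact :=
  ShortComplex.exact_of_g_is_cokernel _ P.isColimitCokernelCofork

theorem d_augmentation_ι {F M : C} (p : F ⟶ M) (P : ProjectiveResolution (kernel p)) :
    P.complex.d 1 0 ≫ augmentation P ≫ kernel.ι p = 0 := by
  rw [← Category.assoc, d_augmentation, zero_comp]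

theorem augmentation_ι_p {F M : C} (p : F ⟶ M) (P : ProjectiveResolution (kernel p)) :
    (augmentation P ≫ kernel.ι p) ≫ p = 0 := by
  rw [Category.assoc, kernel.condition, comp_zero]

theorem augmentation_ι_p_exact {F M : C} (p : F ⟶ M) (P : ProjectiveResolution (kernel p)) :
    (ShortComplex.mk _ _ (augmentation_ι_p p P)).Exact := by
  let φ : ShortComplex.mk _ _ (augmentation_ι_p p P) ⟶ ShortComplex.mk _ _ (kernel.condition p) :=
    { τ₁ := augmentation P
      τ₂ := 𝟙 _
      τ₃ := 𝟙 _ }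
  have : Epi φ.τ₁ := inferInstanceAs (Epi (augmentation P))
  have : IsIso φ.τ₂ := inferInstanceAs (IsIso (𝟙 _))
  have : Mono φ.τ₃ := inferInstanceAs (Mono (𝟙 _))
  exact (ShortComplex.exact_iff_of_epi_of_isIso_of_mono φ).2 (ShortComplex.exact_kernel p)

theorem d_augmentation_ι_exact {F M : C} (p : F ⟶ M) (P : ProjectiveResolution (kernel p)) :
    (ShortComplex.mk _ _ (d_augmentation_ι p P)).Exact := by
  let φ : ShortComplex.mk _ _ (d_augmentation P) ⟶ ShortComplex.mk _ _ (d_augmentation_ι p P) :=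
    { τ₁ := 𝟙 _
      τ₂ := 𝟙 _
      τ₃ := kernel.ι p }
  have : Epi φ.τ₁ := inferInstanceAs (Epi (𝟙 _))
  have : IsIso φ.τ₂ := inferInstanceAs (IsIso (𝟙 _))
  have : Mono φ.τ₃ := inferInstanceAs (Mono (kernel.ι p))
  exact (ShortComplex.exact_iff_of_epi_of_isIso_of_mono φ).1 (augmentation_exact P)

/-- A projective resolution of the kernel of an epimorphism `p : F → M` with `F` projective, spliced
with `F`, is a projective resolution of `M`. -/
def spliceResolution {F M : C} (p : F ⟶ M) [Epi p] [Projective F]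
    (P : ProjectiveResolution (kernel p)) : ProjectiveResolution M where
  complex := P.complex.augment (augmentation P ≫ kernel.ι p) (d_augmentation_ι p P)
  projective n := by
    cases n with
    | zero => assumption
    | succ n => exact P.projective n
  π := (ChainComplex.toSingle₀Equiv _ _).symm ⟨p, augmentation_ι_p p P⟩
  quasiIso := ⟨fun n => by
    rcases n with _ | _ | n
    · rw [ChainComplex.quasiIsoAt₀_iff, ShortComplex.quasiIso_iff_of_zeros']
      · refine (ShortComplex.exact_and_epi_g_iff_of_iso ?_).2
          (⟨augmentation_ι_p_exact p P, ‹Epi p›⟩ :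
            (ShortComplex.mk _ _ (augmentation_ι_p p P)).Exact ∧ Epi p)
        refine ShortComplex.isoMk (Iso.refl _) (Iso.refl _) (Iso.refl _)
          ((Category.id_comp _).trans (Category.comp_id _).symm) ?_
        refine (Category.id_comp _).trans (Eq.trans ?_ (Category.comp_id _).symm)
        exact (ChainComplex.toSingle₀Equiv_symm_apply_f_zero
          (C := P.complex.augment (augmentation P ≫ kernel.ι p) (d_augmentation_ι p P))
          p (augmentation_ι_p p P)).symm
      all_goals rfl
    · rw [quasiIsoAt_iff_exactAt']
      · rw [HomologicalComplex.exactAt_iff' _ 2 1 0 (by simp) (by simp)]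
        exact d_augmentation_ι_exact p P
      · apply ChainComplex.exactAt_succ_single_obj
    · rw [quasiIsoAt_iff_exactAt']
      · rw [HomologicalComplex.exactAt_iff' _ (n + 3) (n + 2) (n + 1) (by simp) (by simp)]
        exact P.exact_succ n
      · apply ChainComplex.exactAt_succ_single_obj⟩

theorem spliceResolution_π_f_zero {F M : C} (p : F ⟶ M) [Epi p] [Projective F]
    (P : ProjectiveResolution (kernel p)) : (spliceResolution p P).π.f 0 = p :=
  ChainComplex.toSingle₀Equiv_symm_apply_f_zero ..

/-- The map between spliced resolutions induced by a map of the underlying short exact sequences and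
a lift of its restriction to kernels. -/
def spliceMap {F M F' M' : C} {p : F ⟶ M} {p' : F' ⟶ M'} [Epi p] [Projective F] [Epi p']
    [Projective F'] (P : ProjectiveResolution (kernel p)) (P' : ProjectiveResolution (kernel p'))
    (a : F ⟶ F') (f : kernel p ⟶ kernel p') (haf : kernel.ι p ≫ a = f ≫ kernel.ι p')
    (φ : P.complex ⟶ P'.complex) (hφ : φ.f 0 ≫ augmentation P' = augmentation P ≫ f) :
    (spliceResolution p P).complex ⟶ (spliceResolution p' P').complex where
  f n := match n with
    | 0 => a
    | n + 1 => φ.f n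
  comm' i j hij := by
    obtain rfl : j + 1 = i := hij
    rcases j with _ | j
    · change φ.f 0 ≫ augmentation P' ≫ kernel.ι p' = (augmentation P ≫ kernel.ι p) ≫ a
      rw [← Category.assoc, hφ, Category.assoc, Category.assoc, haf]
    · exact φ.comm (j + 1) j

/-- A functorial presentation of every object as a quotient of a projective object. -/
structure FunctorialPresentation (C : Type*) [Category* C] [Abelian C] where
  /-- The projective object that covers `M`. -/
  F : C ⥤ C
  /-- The projection onto the covered object. -/
  π : F ⟶ 𝟭 C
  projective (M : C) : Projective (F.obj M)
  epi (M : C) : Epi (π.app M)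

attribute [instance] FunctorialPresentation.projective FunctorialPresentation.epi

namespace FunctorialPresentation

variable (Λ : FunctorialPresentation C)

/-- The syzygy functor `M ↦ ker(F M → M)`. -/
def syz : C ⥤ C where
  obj M := kernel (Λ.π.app M)
  map {M N} f := kernel.map _ _ (Λ.F.map f) f (Λ.π.naturality f).symm

/-- The inclusion of the syzygy into the covering projective object. -/
def ι : Λ.syz ⟶ Λ.F where
  app M := kernel.ι (Λ.π.app M)
  naturality _ _ _ := kernel.lift_ι _ _ _

theorem ι_π (M : C) : Λ.ι.app M ≫ Λ.π.app M = 0 := kernel.condition _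

/-- The short exact sequence `0 → syz M → F M → M → 0`. -/
def shortComplex (M : C) : ShortComplex C := ShortComplex.mk (Λ.ι.app M) (Λ.π.app M) (Λ.ι_π M)

theorem shortExact (M : C) : (Λ.shortComplex M).ShortExact where
  exact := ShortComplex.exact_kernel (Λ.π.app M)
  mono_f := inferInstanceAs (Mono (kernel.ι (Λ.π.app M : Λ.F.obj M ⟶ M)))
  epi_g := Λ.epi M

/-- The map of short exact sequences induced by a map `M → N`. -/
def shortComplexMap {M N : C} (f : M ⟶ N) : Λ.shortComplex M ⟶ Λ.shortComplex N where
  τ₁ := Λ.syz.map f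
  τ₂ := Λ.F.map f
  τ₃ := f
  comm₁₂ := Λ.ι.naturality f
  comm₂₃ := Λ.π.naturality f

variable [HasProjectiveResolutions C]

/-- The resolution of `M` spliced from the chosen resolution of its syzygy. -/
def splice (M : C) : ProjectiveResolution M :=
  spliceResolution (Λ.π.app M) (projectiveResolution (Λ.syz.obj M))

theorem splice_π_f_zero (M : C) : (Λ.splice M).π.f 0 = Λ.π.app M :=
  spliceResolution_π_f_zero _ _

/-- A lift of `f : M → N` to the spliced resolutions. -/
def spliceLift {M N : C} (f : M ⟶ N) : (Λ.splice M).complex ⟶ (Λ.splice N).complex :=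
  spliceMap (projectiveResolution (Λ.syz.obj M)) (projectiveResolution (Λ.syz.obj N))
    (Λ.F.map f) (Λ.syz.map f) (kernel.lift_ι _ _ _).symm
    (ProjectiveResolution.lift (Λ.syz.map f) _ _)
    (ProjectiveResolution.lift_commutes_zero _ _ _)

variable {D : Type*} [Category* D] [Abelian D] (G : C ⥤ D) [G.Additive]

/-- `L_{n+1} G (M)` is the homology of `G` applied to the spliced resolution. -/
def leftDerivedIsoSplice (n : ℕ) (M : C) : (G.leftDerived n).obj M ≅
    ((G.mapHomologicalComplex _).obj (Λ.splice M).complex).homology n :=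
  (Λ.splice M).isoLeftDerivedObj G n

theorem leftDerivedIsoSplice_naturality (n : ℕ) {M N : C} (f : M ⟶ N) :
    (G.leftDerived n).map f ≫ (Λ.leftDerivedIsoSplice G n N).hom =
      (Λ.leftDerivedIsoSplice G n M).hom ≫
        HomologicalComplex.homologyMap ((G.mapHomologicalComplex _).map (Λ.spliceLift f)) n :=
  ProjectiveResolution.isoLeftDerivedObj_hom_naturality f (Λ.splice M) (Λ.splice N)
    (Λ.spliceLift f) (((congrArg (Λ.F.map f ≫ ·) (Λ.splice_π_f_zero N)).trans
      (Λ.π.naturality f)).trans (congrArg (· ≫ f) (Λ.splice_π_f_zero M)).symm) G n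

end FunctorialPresentation

namespace FunctorialPresentation

variable {C : Type*} [Category* C] [Abelian C] (Λ : FunctorialPresentation C)

section MapAug

variable [HasProjectiveResolutions C] {D : Type*} [Category* D] (G : C ⥤ D)

/-- The map `G(P₀) → G(syz M)` induced by the augmentation of the chosen resolution of `syz M`. -/
def mapAug (M : C) : G.obj ((projectiveResolution (Λ.syz.obj M)).complex.X 0) ⟶
    G.obj (Λ.syz.obj M) := G.map (augmentation _)

theorem mapAug_naturality {M N : C} (f : M ⟶ N) :
    G.map ((ProjectiveResolution.lift (Λ.syz.map f) (projectiveResolution (Λ.syz.obj M))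
      (projectiveResolution (Λ.syz.obj N))).f 0) ≫ Λ.mapAug G N =
      Λ.mapAug G M ≫ G.map (Λ.syz.map f) := by
  refine (G.map_comp _ _).symm.trans (Eq.trans ?_ (G.map_comp _ _))
  exact congrArg G.map (ProjectiveResolution.lift_commutes_zero _ _ _)

end MapAug

variable {D : Type*} [Category* D] [Abelian D] (G : C ⥤ D)

/-- The functor `M ↦ ker(G(syz M) → G(F M))`. -/
def kerι : C ⥤ D where
  obj M := kernel (G.map (Λ.ι.app M))
  map {M N} f := kernel.map _ _ (G.map (Λ.syz.map f)) (G.map (Λ.F.map f)) (by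
    rw [← G.map_comp, ← G.map_comp, Λ.ι.naturality])
  map_id M := by
    rw [← cancel_mono (kernel.ι _), kernel.map, kernel.lift_ι, Λ.syz.map_id, G.map_id]
    simp
  map_comp f g := by
    rw [← cancel_mono (kernel.ι _), kernel.map, kernel.lift_ι, Λ.syz.map_comp, G.map_comp]
    simp [kernel.map]

/-- The inclusion of `ker(G(syz M) → G(F M))` into `G(syz M)`. -/
def kerIncl (M : C) : (Λ.kerι G).obj M ⟶ G.obj (Λ.syz.obj M) := kernel.ι (G.map (Λ.ι.app M))

instance (M : C) : Mono (Λ.kerIncl G M) := inferInstanceAs (Mono (kernel.ι _))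

theorem kerι_map_kerIncl {M N : C} (f : M ⟶ N) :
    (Λ.kerι G).map f ≫ Λ.kerIncl G N = Λ.kerIncl G M ≫ G.map (Λ.syz.map f) :=
  kernel.lift_ι _ _ _

variable {G} in
/-- A map into `G(syz M)` that vanishes in `G(F M)` factors through the kernel. -/
def kerLift {M : C} {Y : D} (f : Y ⟶ G.obj (Λ.syz.obj M)) (w : f ≫ G.map (Λ.ι.app M) = 0) :
    Y ⟶ (Λ.kerι G).obj M := kernel.lift _ f w

variable {G} in
theorem kerLift_kerIncl {M : C} {Y : D} (f : Y ⟶ G.obj (Λ.syz.obj M))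
    (w : f ≫ G.map (Λ.ι.app M) = 0) : Λ.kerLift f w ≫ Λ.kerIncl G M = f :=
  kernel.lift_ι _ _ _

variable {G} in
theorem isIso_kerLift {M : C} {Y : D} (f : Y ⟶ G.obj (Λ.syz.obj M)) [Mono f]
    (w : f ≫ G.map (Λ.ι.app M) = 0) (h : (ShortComplex.mk f _ w).Exact) :
    IsIso (Λ.kerLift f w) := by
  have : Mono (Λ.kerLift f w) := mono_of_mono_fac (Λ.kerLift_kerIncl f w)
  have : Epi (Λ.kerLift f w) := (ShortComplex.exact_iff_epi_kernel_lift _).1 h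
  exact isIso_of_mono_of_epi _

variable [G.Additive]

variable {G} in
theorem map_exact_of_preservesFiniteColimits [PreservesFiniteColimits G] {S : ShortComplex C}
    (hS : S.Exact) (h : Epi S.g) : (S.map G).Exact := by
  have := (Functor.preservesFiniteColimits_tfae G).out 3 1
  exact (this.1 ‹_› S ⟨hS, h⟩).1

variable [HasProjectiveResolutions C]

/-- In degrees `≥ 2`, left derived functors of `M` are left derived functors of the syzygy of `M`,
one degree lower. -/
def leftDerivedShiftIso (n : ℕ) : G.leftDerived (n + 2) ≅ Λ.syz ⋙ G.leftDerived (n + 1) :=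
  NatIso.ofComponents (fun M => Λ.leftDerivedIsoSplice G (n + 2) M ≪≫
      (HomologicalComplex.homologyFunctorIso' D (ComplexShape.down ℕ) (n + 3) (n + 2) (n + 1)
        (by simp) (by simp)).app _ ≪≫
      ((HomologicalComplex.homologyFunctorIso' D (ComplexShape.down ℕ) (n + 2) (n + 1) n
        (by simp) (by simp)).app
          ((G.mapHomologicalComplex _).obj (projectiveResolution (Λ.syz.obj M)).complex)).symm ≪≫
      ((projectiveResolution (Λ.syz.obj M)).isoLeftDerivedObj G (n + 1)).symm)
    (by
      intro M N f
      refine (CommSq.horiz_comp ⟨(Λ.leftDerivedIsoSplice_naturality G (n + 2) f).symm⟩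
        (CommSq.horiz_comp
          ⟨((HomologicalComplex.homologyFunctorIso' D (ComplexShape.down ℕ) (n + 3) (n + 2) (n + 1)
            (by simp) (by simp)).hom.naturality
              ((G.mapHomologicalComplex _).map (Λ.spliceLift f))).symm⟩
          (CommSq.horiz_comp
            ⟨((HomologicalComplex.homologyFunctorIso' D (ComplexShape.down ℕ) (n + 2) (n + 1) n
              (by simp) (by simp)).inv.naturality ((G.mapHomologicalComplex _).map
                (ProjectiveResolution.lift (Λ.syz.map f) _ _))).symm⟩
            ⟨(ProjectiveResolution.isoLeftDerivedObj_inv_naturality (Λ.syz.map f) _ _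
              (ProjectiveResolution.lift (Λ.syz.map f) _ _)
              (ProjectiveResolution.lift_commutes_zero _ _ _) G (n + 1))⟩))).w.symm)

variable [PreservesFiniteColimits G]

instance (M : C) : Epi (Λ.mapAug G M) := inferInstanceAs (Epi (G.map (augmentation _)))

/-- The short complex computing `L₁ G (M)` from the spliced resolution. -/
abbrev spliceSc (M : C) : ShortComplex D :=
  ((G.mapHomologicalComplex (ComplexShape.down ℕ)).obj (Λ.splice M).complex).sc' 2 1 0

/-- For right exact `G`, `L₁ G (M)` is the kernel of `G(syz M) → G(F M)`. -/
def spliceHomologyData (M : C) : (Λ.spliceSc G M).RightHomologyData :=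
  let P := projectiveResolution (Λ.syz.obj M)
  have hex := map_exact_of_preservesFiniteColimits (G := G) (augmentation_exact P)
    (inferInstanceAs (Epi (augmentation P)))
  have : Epi ((ShortComplex.mk _ _ (d_augmentation P)).map G).g :=
    inferInstanceAs (Epi (G.map (augmentation P)))
  have hdesc : hex.gIsCokernel.desc (CokernelCofork.ofπ (Λ.spliceSc G M).g
      (Λ.spliceSc G M).zero) = G.map (Λ.ι.app M) := by
    refine (cancel_epi (Λ.mapAug G M)).1 ?_
    exact (Cofork.IsColimit.π_desc hex.gIsCokernel).trans (G.map_comp _ _)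
  { Q := G.obj (Λ.syz.obj M)
    H := (Λ.kerι G).obj M
    p := Λ.mapAug G M
    ι := kernel.ι (G.map (Λ.ι.app M))
    wp := ((ShortComplex.mk _ _ (d_augmentation P)).map G).zero
    hp := hex.gIsCokernel
    wι := (congrArg (_ ≫ ·) hdesc).trans (kernel.condition _)
    hι := KernelFork.isLimitOfIsLimitOfIff' (kernelIsKernel (G.map (Λ.ι.app M))) _
      fun W φ => by
        have h : φ ≫ hex.gIsCokernel.desc (CokernelCofork.ofπ (Λ.spliceSc G M).g
          (Λ.spliceSc G M).zero) = φ ≫ G.map (Λ.ι.app M) := congrArg (φ ≫ ·) hdesc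
        exact ⟨h.trans, h.symm.trans⟩ }

theorem spliceHomologyData_g' (M : C) : (Λ.spliceHomologyData G M).g' = G.map (Λ.ι.app M) := by
  refine (cancel_epi (Λ.mapAug G M)).1 ?_
  exact ((Λ.spliceHomologyData G M).p_g').trans (G.map_comp _ _)

/-- The map of right homology data induced by a map `M → N`. -/
def spliceHomologyMapData {M N : C} (f : M ⟶ N) :
    ShortComplex.RightHomologyMapData
      ((HomologicalComplex.shortComplexFunctor' D (ComplexShape.down ℕ) 2 1 0).map
        ((G.mapHomologicalComplex _).map (Λ.spliceLift f)))
      (Λ.spliceHomologyData G M) (Λ.spliceHomologyData G N) where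
  φQ := G.map (Λ.syz.map f)
  φH := (Λ.kerι G).map f
  commp := (Λ.mapAug_naturality G f).symm
  commg' := by
    rw [spliceHomologyData_g', spliceHomologyData_g']
    refine (G.map_comp _ _).symm.trans (Eq.trans ?_ (G.map_comp _ _))
    exact congrArg G.map (Λ.ι.naturality f)
  commι := Λ.kerι_map_kerIncl G f

/-- For right exact `G`, the first left derived functor at `M` is the kernel of
`G(syz M) → G(F M)`. -/
def leftDerivedOneIso : G.leftDerived 1 ≅ Λ.kerι G :=
  NatIso.ofComponents (fun M => Λ.leftDerivedIsoSplice G 1 M ≪≫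
      (HomologicalComplex.homologyFunctorIso' D (ComplexShape.down ℕ) 2 1 0
        (by simp) (by simp)).app _ ≪≫ (Λ.spliceHomologyData G M).homologyIso) (by
      intro M N f
      exact (CommSq.horiz_comp ⟨(Λ.leftDerivedIsoSplice_naturality G 1 f).symm⟩
        (CommSq.horiz_comp
          ⟨((HomologicalComplex.homologyFunctorIso' D (ComplexShape.down ℕ) 2 1 0
            (by simp) (by simp)).hom.naturality
              ((G.mapHomologicalComplex _).map (Λ.spliceLift f))).symm⟩
          ⟨(Λ.spliceHomologyMapData G f).homologyMap_comm.symm⟩)).w.symm)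

end FunctorialPresentation

end DimensionShift

/-! ### Dimension shifting for Ext -/

section ExtShift

open Limits Abelian

variable {C : Type u} [Category.{v} C] [Abelian C] [HasExt.{v} C]

/-- `Ext^n(X, -)` is right exact if `Ext^{n+1}(X, -)` vanishes. -/
theorem preservesFiniteColimits_ext (X : C) (n : ℕ) (h : ∀ Y, Subsingleton (Ext X Y (n + 1))) :
    PreservesFiniteColimits (extFunctorObj X n) := by
  rw [Functor.preservesFiniteColimits_iff_forall_exact_map_and_epi]
  intro S hS
  refine ⟨Ext.covariant_sequence_exact₂' X hS n, ?_⟩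
  rw [AddCommGrpCat.epi_iff_surjective]
  intro x
  exact Ext.covariant_sequence_exact₃ X hS x rfl (Subsingleton.elim _ _)

namespace FunctorialPresentation

variable (Λ : FunctorialPresentation C) (X : C)

/-- The class in `Ext¹(M, syz M)` of the short exact sequence `0 → syz M → F M → M → 0`. -/
def extCls (M : C) : Ext M (Λ.syz.obj M) 1 := (Λ.shortExact M).extClass

theorem extCls_naturality {M N : C} (f : M ⟶ N) :
    (Λ.extCls M).comp (Ext.mk₀ (Λ.syz.map f)) (add_zero 1) =
      (Ext.mk₀ f).comp (Λ.extCls N) (zero_add 1) :=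
  ShortComplex.ShortExact.extClass_naturality (Λ.shortExact M) (Λ.shortExact N)
    (Λ.shortComplexMap f)

/-- The connecting map `Ext^n(X, M) → Ext^{n+1}(X, syz M)`, as a natural transformation. -/
def extδ (n : ℕ) : extFunctorObj X n ⟶ Λ.syz ⋙ extFunctorObj X (n + 1) where
  app M := AddCommGrpCat.ofHom ((Λ.extCls M).postcomp X rfl)
  naturality M N f := AddCommGrpCat.hom_ext (AddMonoidHom.ext fun (x : Ext X M n) => by
    change (x.comp (Ext.mk₀ f) (add_zero n)).comp (Λ.extCls N) rfl =
      (x.comp (Λ.extCls M) rfl).comp (Ext.mk₀ (Λ.syz.map f)) (add_zero (n + 1))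
    rw [Ext.comp_assoc_of_second_deg_zero, ← extCls_naturality, Ext.comp_assoc_of_third_deg_zero])

theorem extδ_injective (n : ℕ) (M : C) (h : Subsingleton (Ext X (Λ.F.obj M) n)) :
    Function.Injective ((Λ.extδ X n).app M).hom := by
  rw [injective_iff_map_eq_zero]
  intro x hx
  obtain ⟨y, rfl⟩ := Ext.covariant_sequence_exact₃ X (Λ.shortExact M) x rfl hx
  have hy : y = 0 := Subsingleton.elim (h := h) _ _
  rw [hy]
  exact map_zero ((extFunctorObj X n).map (Λ.π.app M)).hom

theorem extδ_exact (n : ℕ) (M : C) :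
    ∃ w : (Λ.extδ X n).app M ≫ (extFunctorObj X (n + 1)).map (Λ.ι.app M) = 0,
      (ShortComplex.mk _ _ w).Exact :=
  ⟨_, Ext.covariant_sequence_exact₁' X (Λ.shortExact M) n (n + 1) rfl⟩

theorem exists_extδ_eq (n : ℕ) (M : C) (y : Ext X (Λ.syz.obj M) (n + 1))
    (hy : ((extFunctorObj X (n + 1)).map (Λ.ι.app M)).hom y = 0) :
    ∃ x : Ext X M n, ((Λ.extδ X n).app M).hom x = y :=
  Ext.covariant_sequence_exact₁ X (Λ.shortExact M) y hy rfl

/-- `Ext^n(X, M) ≅ Ext^{n+1}(X, syz M)` when both `Ext^n(X, -)` and `Ext^{n+1}(X, -)` vanish on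
the covering projectives. -/
def extShiftIso (n : ℕ) (h : ∀ M, Subsingleton (Ext X (Λ.F.obj M) n))
    (h' : ∀ M, Subsingleton (Ext X (Λ.F.obj M) (n + 1))) :
    extFunctorObj X n ≅ Λ.syz ⋙ extFunctorObj X (n + 1) :=
  have : ∀ M, IsIso ((Λ.extδ X n).app M) := fun M =>
    (ConcreteCategory.isIso_iff_bijective _).2 ⟨Λ.extδ_injective X n M (h M), fun y =>
      Λ.exists_extδ_eq X n M y (Subsingleton.elim (h := h' M) _ _)⟩
  have := NatIso.isIso_of_isIso_app (Λ.extδ X n)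
  asIso (Λ.extδ X n)

/-- `Ext^n(X, M)` is the kernel of `Ext^{n+1}(X, syz M) → Ext^{n+1}(X, F M)` when `Ext^n(X, -)`
vanishes on the covering projectives. -/
def extKernelIso (n : ℕ) (h : ∀ M, Subsingleton (Ext X (Λ.F.obj M) n)) :
    extFunctorObj X n ≅ Λ.kerι (extFunctorObj X (n + 1)) :=
  let τ : extFunctorObj X n ⟶ Λ.kerι (extFunctorObj X (n + 1)) :=
    { app := fun M => Λ.kerLift ((Λ.extδ X n).app M) (Λ.extδ_exact X n M).choose
      naturality := fun M N f => by
        refine (cancel_mono (Λ.kerIncl (extFunctorObj X (n + 1)) N)).1 ?_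
        rw [Category.assoc, Category.assoc, kerLift_kerIncl, kerι_map_kerIncl,
          ← Category.assoc (Λ.kerLift _ _), kerLift_kerIncl]
        exact (Λ.extδ X n).naturality f }
  have : ∀ M, IsIso (τ.app M) := fun M => by
    have : Mono ((Λ.extδ X n).app M) :=
      (AddCommGrpCat.mono_iff_injective _).2 (Λ.extδ_injective X n M (h M))
    exact Λ.isIso_kerLift _ _ (Λ.extδ_exact X n M).choose_spec
  have := NatIso.isIso_of_isIso_app τ
  asIso τ

/-- If `Ext^i(X, -)` vanishes for `i > d`, and vanishes on the covering projectives for `i < d`,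
then the functors `Ext^{d-n}(X, -)` are the left derived functors of `Ext^d(X, -)`. -/
theorem leftDerived_ext_iso [HasProjectiveResolutions C] (d : ℕ)
    (hd : ∀ Y, Subsingleton (Ext X Y (d + 1)))
    (h : ∀ i, i < d → ∀ M, Subsingleton (Ext X (Λ.F.obj M) i)) (n : ℕ) (hn : n ≤ d) :
    Nonempty ((extFunctorObj X d).leftDerived n ≅ extFunctorObj X (d - n)) := by
  have := preservesFiniteColimits_ext X d hd
  induction n with
  | zero => exact ⟨(extFunctorObj X d).leftDerivedZeroIsoSelf⟩
  | succ n ih =>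
    obtain ⟨j, rfl⟩ : ∃ j, d = j + (n + 1) := ⟨d - (n + 1), by omega⟩
    rw [Nat.add_sub_cancel]
    rcases n with _ | n
    · exact ⟨Λ.leftDerivedOneIso (extFunctorObj X (j + 1)) ≪≫
        (Λ.extKernelIso X j (h j (by omega))).symm⟩
    · obtain ⟨e⟩ := ih (by omega)
      rw [show j + (n + 1 + 1) - (n + 1) = j + 1 by omega] at e
      exact ⟨Λ.leftDerivedShiftIso (extFunctorObj X (j + (n + 1 + 1))) n ≪≫
        Functor.isoWhiskerLeft Λ.syz e ≪≫
        (Λ.extShiftIso X j (h j (by omega)) (h (j + 1) (by omega))).symm⟩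

end FunctorialPresentation

end ExtShift

/-- The presentation of modules by the free module on their underlying set. -/
def freePresentation (R : Type u) [Ring R] : FunctorialPresentation (ModuleCat.{u} R) where
  F := forget _ ⋙ ModuleCat.free R
  π := (ModuleCat.adj R).counit
  projective _ := inferInstanceAs (Projective ((ModuleCat.free R).obj _))
  epi _ := inferInstance

section Finite

open Abelian

variable {R : Type u} [Ring R] {X : ModuleCat.{u} R}

theorem subsingleton_ext_of_isZero (P : ProjectiveResolution X) (i : ℕ)
    (h : Limits.IsZero (P.complex.X i)) (Y : ModuleCat.{u} R) : Subsingleton (Ext X Y i) := by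
  refine subsingleton_of_forall_eq 0 fun x => ?_
  obtain ⟨f, hf, rfl⟩ := P.extMk_surjective x (i + 1) rfl
  obtain rfl : f = 0 := h.eq_of_src _ _
  exact P.extMk_zero _ _

/-- If `Ext^i(X, -)` vanishes for large `i`, and vanishes on projectives for `i > d`, then it
vanishes for all `i > d`. -/
theorem subsingleton_ext_of_gt (d N : ℕ) (hN : ∀ i, N < i → ∀ Y, Subsingleton (Ext X Y i))
    (h : ∀ i, d < i → ∀ Q : ModuleCat.{u} R, Projective Q → Subsingleton (Ext X Q i))
    (i : ℕ) (hi : d < i) (Y : ModuleCat.{u} R) : Subsingleton (Ext X Y i) := by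
  by_cases hiN : N < i
  · exact hN i hiN Y
  · have ih := subsingleton_ext_of_gt d N hN h (i + 1) (by omega)
    have hS := (freePresentation R).shortExact Y
    refine subsingleton_of_forall_eq 0 fun x => ?_
    have := h i hi _ ((freePresentation R).projective Y)
    exact (freePresentation R).extδ_injective X i Y this (Subsingleton.elim (h := ih _) _ _)
termination_by N + 1 - i

end Finite

/-! ### Right exactness of tensor products -/

section TensorExact

variable {R : Type u} [Ring R]

/-- The isomorphism `X ⊗_R - ≅ X' ⊗_R -` induced by an isomorphism `X ≅ X'`. -/
def tensorFunctorIso {X X' : ModuleCat.{u} Rᵐᵒᵖ} (e : X ≅ X') :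
    tensorFunctor X ≅ tensorFunctor X' :=
  let f : ∀ {X X' : ModuleCat.{u} Rᵐᵒᵖ} (_ : X ⟶ X') (M : ModuleCat.{u} R),
      BalancedTensor R X M →+ BalancedTensor R X' M := fun g M =>
    BalancedTensor.lift (btmulHom.comp g.hom.toAddMonoidHom) fun x r m => by
      change btmul (g.hom (op r • x)) m = btmul (g.hom x) (r • m)
      rw [map_smul, btmul_balanced]
  have hf : ∀ {X X' : ModuleCat.{u} Rᵐᵒᵖ} (e : X ≅ X') (M : ModuleCat.{u} R) (t),
      f e.inv M (f e.hom M t) = t := fun e M t => by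
    induction t using BalancedTensor.induction with
    | zero => rw [map_zero, map_zero]
    | tmul x m =>
      change btmul (e.inv.hom (e.hom.hom x)) m = btmul x m
      rw [ModuleCat.inv_hom_apply]
    | add s t hs ht => rw [map_add, map_add, hs, ht]
  NatIso.ofComponents
    (fun M => AddEquiv.toAddCommGrpIso (X := AddCommGrpCat.of (BalancedTensor R X M))
      (Y := AddCommGrpCat.of (BalancedTensor R X' M))
      { f e.hom M with
        invFun := f e.inv M
        left_inv := hf e M
        right_inv := hf e.symm M })
    fun _ => AddCommGrpCat.hom_ext (BalancedTensor.hom_ext fun _ _ => rfl)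

theorem tensor_exact (X : ModuleCat.{u} Rᵐᵒᵖ) {S : ShortComplex (ModuleCat.{u} R)}
    (hS : S.ShortExact) :
    (S.map (tensorFunctor X)).Exact ∧ Epi ((tensorFunctor X).map S.g) := by
  have hg : Function.Surjective S.g.hom := (ModuleCat.epi_iff_surjective _).1 hS.epi_g
  refine ⟨?_, (AddCommGrpCat.epi_iff_surjective _).2 (BalancedTensor.map_surjective X hg)⟩
  rw [ShortComplex.ab_exact_iff]
  let N : AddSubgroup (BalancedTensor R X S.X₂) := (BalancedTensor.map X S.f.hom).range
  have : N.Normal := ⟨fun n hn g => by rwa [add_comm g n, add_neg_cancel_right]⟩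
  let q : BalancedTensor R X S.X₂ →+ BalancedTensor R X S.X₂ ⧸ N := QuotientAddGroup.mk' N
  have hq : ∀ (x : X) (y y' : S.X₂), S.g.hom y = S.g.hom y' → q (btmul x y) = q (btmul x y') := by
    intro x y y' h
    have h' : S.g.hom (y - y') = 0 := by rw [map_sub, h, sub_self]
    obtain ⟨z, hz⟩ := (ShortComplex.moduleCat_exact_iff _).1 hS.exact _ h'
    rw [← sub_eq_zero, ← map_sub]
    refine (QuotientAddGroup.eq_zero_iff _).2 ⟨btmul x z, ?_⟩
    change btmul x (S.f.hom z) = _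
    rw [hz, sub_eq_add_neg, btmul_add, sub_eq_add_neg, add_right_inj]
    exact map_neg (btmulHom (R := R) x) y'
  -- Modulo the image of `X ⊗ S.X₁`, a set-theoretic section of `S.g` induces an additive map that
  -- inverts `X ⊗ S.X₂ → X ⊗ S.X₃`.
  let s := Function.surjInv hg
  have hs : ∀ m, S.g.hom (s m) = m := Function.surjInv_eq hg
  let ψ : BalancedTensor R X S.X₃ →+ BalancedTensor R X S.X₂ ⧸ N :=
    BalancedTensor.lift (AddMonoidHom.mk' (fun x : X => AddMonoidHom.mk'
        (fun m : S.X₃ => q (btmul x (s m))) fun m m' => by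
          rw [← map_add, ← btmul_add]
          exact hq _ _ _ (by rw [map_add, hs, hs, hs]))
        fun x x' => AddMonoidHom.ext fun m => by
          change q (btmul (x + x') _) = q _ + q _
          rw [add_btmul, map_add])
      fun x r m => by
        change q (btmul _ _) = q (btmul _ _)
        rw [btmul_balanced]
        exact hq _ _ _ (by rw [map_smul, hs, hs])
  have hψ : ∀ t, ψ (BalancedTensor.map X S.g.hom t) = q t := fun t => by
    induction t using BalancedTensor.induction with
    | zero => rw [map_zero, map_zero, map_zero]
    | tmul x m => exact hq _ _ _ (hs _)
    | add s t hs ht => rw [map_add, map_add, map_add, hs, ht]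
  intro t ht
  have h := hψ t
  rw [show BalancedTensor.map X S.g.hom t = 0 from ht, map_zero] at h
  have ht' : t ∈ (QuotientAddGroup.mk' N).ker := h.symm
  rwa [QuotientAddGroup.ker_mk'] at ht'

instance (X : ModuleCat.{u} Rᵐᵒᵖ) : Limits.PreservesFiniteColimits (tensorFunctor X) :=
  (Functor.preservesFiniteColimits_iff_forall_exact_map_and_epi _).2 fun _ hS => tensor_exact X hS

/-- An isomorphism of additive functors induces isomorphisms of left derived functors. -/
def leftDerivedIso {F G : ModuleCat.{u} R ⥤ AddCommGrpCat.{u}} [F.Additive] [G.Additive]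
    (e : F ≅ G) (n : ℕ) : F.leftDerived n ≅ G.leftDerived n where
  hom := NatTrans.leftDerived e.hom n
  inv := NatTrans.leftDerived e.inv n
  hom_inv_id := by rw [← NatTrans.leftDerived_comp, e.hom_inv_id, NatTrans.leftDerived_id]
  inv_hom_id := by rw [← NatTrans.leftDerived_comp, e.inv_hom_id, NatTrans.leftDerived_id]

end TensorExact

/-! ### Natural isomorphisms on bimodules -/

section OnBimodules

variable {k : Type v} [Field k] {R : Type u} [Ring R] [Algebra k R]

/-- A natural isomorphism between functors on left modules is compatible with any additional right
action. -/
def onBimodulesIso {F G : ModuleCat.{u} R ⥤ AddCommGrpCat.{u}} [F.Additive] [G.Additive]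
    (e : F ≅ G) (C : Type u) [Ring C] [Algebra k C] :
    (onBimodules F : ModuleCat.{u} (R ⊗[k] Cᵐᵒᵖ) ⥤ ModuleCat.{u} Cᵐᵒᵖ) ≅ onBimodules G :=
  NatIso.ofComponents
    (fun M =>
      let f : ∀ {F G : ModuleCat.{u} R ⥤ AddCommGrpCat.{u}} [F.Additive] [G.Additive]
          (_ : F ⟶ G), rightObj F M ⟶ rightObj G M := fun {F G} _ _ α =>
        ModuleCat.ofHom (X := rightObj F M) (Y := rightObj G M)
          { toFun := (α.app ((forgetRight k R C).obj M)).hom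
            map_add' := map_add (α.app ((forgetRight k R C).obj M)).hom
            map_smul' := fun c x =>
              ConcreteCategory.congr_hom (α.naturality (rightMul M c)) x }
      { hom := f e.hom
        inv := f e.inv
        hom_inv_id := ModuleCat.hom_ext (LinearMap.ext fun x =>
          ConcreteCategory.congr_hom (e.hom_inv_id_app ((forgetRight k R C).obj M)) x)
        inv_hom_id := ModuleCat.hom_ext (LinearMap.ext fun x =>
          ConcreteCategory.congr_hom (e.inv_hom_id_app ((forgetRight k R C).obj M)) x) })
    fun f => ModuleCat.hom_ext (LinearMap.ext fun x =>
      ConcreteCategory.congr_hom (e.hom.naturality ((forgetRight k R C).map f)) x)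

variable (k R) in
/-- Multiplication `R ⊗ Z(R)ᵒᵖ → R`, through which any left `R`-module becomes an
`(R, Z(R))`-bimodule. -/
def centerMul : R ⊗[k] (Subalgebra.center k R)ᵐᵒᵖ →ₐ[k] R :=
  Algebra.TensorProduct.lift (AlgHom.id k R)
    ((Subalgebra.center k R).val.comp (AlgEquiv.toOpposite k (Subalgebra.center k R)).symm.toAlgHom)
    fun r c => (Subalgebra.mem_center_iff.1 (unop c).2 r)

variable (k R) in
/-- A left `R`-module, as a bimodule over `R` and its centre. -/
def centralBimodule : ModuleCat.{u} R ⥤ ModuleCat.{u} (R ⊗[k] (Subalgebra.center k R)ᵐᵒᵖ) :=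
  ModuleCat.restrictScalars (centerMul k R).toRingHom

variable (k R) in
/-- The left module underlying `centralBimodule M` is `M`. -/
def centralBimoduleForget :
    centralBimodule k R ⋙ forgetRight k R (Subalgebra.center k R) ≅ 𝟭 (ModuleCat.{u} R) :=
  NatIso.ofComponents (fun M => LinearEquiv.toModuleIso
    ({ AddEquiv.refl M with
        map_smul' := fun r m => by
          have h : centerMul k R (r ⊗ₜ 1) = r :=
            (Algebra.TensorProduct.lift_tmul _ _ _ r 1).trans (by rw [map_one, mul_one]; rfl)
          exact congrArg (fun s : R => HSMul.hSMul (β := M) (γ := M) s m) h } :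
      ((forgetRight k R _).obj ((centralBimodule k R).obj M) : ModuleCat.{u} R) ≃ₗ[R] M))
    fun _ => rfl

/-- Natural isomorphisms on `(R, C)`-bimodules for all `C` give a natural isomorphism on left
`R`-modules: take for `C` the centre of `R`. -/
theorem iso_of_onBimodules_iso {F G : ModuleCat.{u} R ⥤ AddCommGrpCat.{u}} [F.Additive]
    [G.Additive] (h : ∀ (C : Type u) [Ring C] [Algebra k C],
      Nonempty ((onBimodules F : ModuleCat.{u} (R ⊗[k] Cᵐᵒᵖ) ⥤ ModuleCat.{u} Cᵐᵒᵖ) ≅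
        onBimodules G)) : Nonempty (F ≅ G) := by
  obtain ⟨e⟩ := h (Subalgebra.center k R)
  have step : ∀ (F : ModuleCat.{u} R ⥤ AddCommGrpCat.{u}) [F.Additive],
      Nonempty (centralBimodule k R ⋙ onBimodules F ⋙ forget₂ _ AddCommGrpCat.{u} ≅ F) :=
    fun F _ => ⟨Iso.trans (NatIso.ofComponents (fun M => Iso.refl _) (fun f => by
        rw [Iso.refl_hom, Iso.refl_hom, Category.comp_id, Category.id_comp]) :
      _ ≅ (centralBimodule k R ⋙ forgetRight k R (Subalgebra.center k R)) ⋙ F)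
      (Functor.isoWhiskerRight (centralBimoduleForget k R) F ≪≫ F.leftUnitor)⟩
  obtain ⟨a⟩ := step F
  obtain ⟨b⟩ := step G
  exact ⟨a.symm ≪≫ Functor.isoWhiskerLeft _ (Functor.isoWhiskerRight e _) ≪≫ b⟩

end OnBimodules

/-! ### The value of a tensor product functor at the ring -/

section TensorRegular

variable (k : Type v) [Field k] {R : Type u} [Ring R] [Algebra k R]

/-- The map `X ⊗_R R → X`, `x ⊗ r ↦ x r`. -/
def tensorRegularHom (X : ModuleCat.{u} Rᵐᵒᵖ) : BalancedTensor R X (regularLeft k R) →+ X :=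
  BalancedTensor.lift (AddMonoidHom.mk' (fun x : X => AddMonoidHom.mk'
      (fun r : regularLeft k R => op ((regEquiv k).symm r) • x) fun r s => by
        rw [map_add, MulOpposite.op_add, add_smul])
      fun x y => AddMonoidHom.ext fun r => smul_add _ x y)
    fun x r s => by
      change op ((regEquiv k).symm s) • (op r • x) = op ((regEquiv k).symm (r • s)) • x
      rw [regEquiv_symm_smul, MulOpposite.op_mul, mul_smul]

theorem tensorRegularHom_btmul (X : ModuleCat.{u} Rᵐᵒᵖ) (x : X) (r : R) :
    tensorRegularHom k X (btmul x (regEquiv k r)) = op r • x := rfl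

theorem btmul_tensorRegularHom (X : ModuleCat.{u} Rᵐᵒᵖ)
    (t : BalancedTensor R X (regularLeft k R)) :
    btmul (tensorRegularHom k X t) (regEquiv k 1) = t := by
  induction t using BalancedTensor.induction with
  | zero => rw [map_zero, zero_btmul]
  | tmul x r =>
    obtain ⟨r, rfl⟩ := (regEquiv k).surjective r
    rw [tensorRegularHom_btmul, btmul_balanced, smul_regEquiv, mul_one]
  | add s t hs ht => rw [map_add, add_btmul, hs, ht]

/-- The isomorphism `X ⊗_R R ≅ X` of right `R`-modules. -/
def tensorRegularIso (X : ModuleCat.{u} Rᵐᵒᵖ) : valueAtRegular k (tensorFunctor X) ≅ X :=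
  LinearEquiv.toModuleIso
    ({ tensorRegularHom k X with
        invFun := fun x => btmul x (regEquiv k 1)
        left_inv := btmul_tensorRegularHom k X
        right_inv := fun x => by
          refine (tensorRegularHom_btmul k X x 1).trans ?_
          rw [MulOpposite.op_one, one_smul]
        map_smul' := fun c t => by
          change tensorRegularHom k X (BalancedTensor.map X
            (rightMul (regularBimodule k R) c).hom t) = c • tensorRegularHom k X t
          induction t using BalancedTensor.induction with
          | zero => rw [map_zero, map_zero, smul_zero]
          | tmul x r =>
            obtain ⟨r, rfl⟩ := (regEquiv k).surjective r
            rw [BalancedTensor.map_btmul, tensorRegularHom_btmul]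
            refine (congrArg (fun s => tensorRegularHom k X (btmul x s))
              (rightMul_regular_apply k (unop c) r)).trans ?_
            rw [tensorRegularHom_btmul, MulOpposite.op_mul, op_unop, mul_smul]
          | add s t hs ht => rw [map_add, map_add, map_add, smul_add, hs, ht] } :
      valueAtRegular k (tensorFunctor X) ≃ₗ[Rᵐᵒᵖ] X)

instance projective_regularLeft : Projective (regularLeft k R) :=
  Projective.of_iso (LinearEquiv.toModuleIso
    ({ regEquiv (R := R) k with
        map_smul' := fun r x => (smul_regEquiv k r x).symm } : R ≃ₗ[R] regularLeft k R))
    ((IsProjective.iff_projective (R := R) R).1 inferInstance)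

end TensorRegular

/-! ### The functorial characterization of the twisted Calabi-Yau property -/

section Criterion

open Abelian

variable (k : Type v) [Field k] (A : Type u) [Ring A] [Algebra k A]

theorem isZero_extEnv_iff (i : ℕ) : Limits.IsZero (extEnv k A i) ↔
    Subsingleton ((extFromRegular k A i).obj (regularLeft k (Env k A))) :=
  ModuleCat.isZero_iff_subsingleton

variable {k A} in
theorem HomologicallySmooth.finitaryOnFree (h : HomologicallySmooth k A) (i : ℕ) :
    FinitaryOnFree k (extFromRegular k A i) := by
  obtain ⟨P, hP, -⟩ := h
  have := hP i
  exact finitaryOnFree_ext k P i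

variable {k A} in
/-- If `A` is homologically smooth and `Ext^i(A, A^e) = 0` for `i > d`, then `Ext^i(A, -) = 0` for
`i > d`. -/
theorem HomologicallySmooth.subsingleton_ext (h : HomologicallySmooth k A) (d : ℕ)
    (hd : ∀ i, i ≠ d → Subsingleton ((extFromRegular k A i).obj (regularLeft k (Env k A))))
    (i : ℕ) (hi : d < i) (M : ModuleCat.{u} (Env k A)) :
    Subsingleton (Ext (regularBimodule k A) M i) := by
  have hfin := h.finitaryOnFree
  obtain ⟨P, -, N, hN⟩ := h
  refine subsingleton_ext_of_gt d N (fun i hi => subsingleton_ext_of_isZero P i (hN i hi)) ?_ i hi M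
  intro i hi Q hQ
  have := hd i hi.ne'
  exact (hfin i).subsingleton_of_projective Q

/-- The twisted Calabi-Yau property in terms of functors on `A^e`-modules: `Ext^i(A, A^e)` vanishes
for `i ≠ d`, and `Ext^d(A, -)` is isomorphic to `U ⊗_{A^e} -`. -/
theorem isTwistedCYWith_iff (d : ℕ) (U : ModuleCat.{u} (Env k A)) :
    IsTwistedCYWith k A d U ↔ HomologicallySmooth k A ∧ IsInvertible k U ∧
      (∀ i, i ≠ d → Subsingleton ((extFromRegular k A i).obj (regularLeft k (Env k A)))) ∧
      Nonempty (tensorFunctor ((toRightEnv k A).obj U) ≅ extFromRegular k A d) := by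
  constructor
  · rintro ⟨hs, hU, h0, ⟨e⟩⟩
    have h0' : ∀ i, i ≠ d → Subsingleton ((extFromRegular k A i).obj (regularLeft k (Env k A))) :=
      fun i hi => (isZero_extEnv_iff k A i).1 (h0 i hi)
    refine ⟨hs, hU, h0', ⟨tensorFunctorIso e.symm ≪≫
      FinitaryOnFree.wattsIso k (hs.finitaryOnFree d) ?_⟩⟩
    have := preservesFiniteColimits_ext (regularBimodule k A) d
      (hs.subsingleton_ext d h0' (d + 1) (by omega))
    exact (Functor.preservesFiniteColimits_iff_forall_exact_map_and_epi _).1 this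
  · rintro ⟨hs, hU, h0, ⟨e⟩⟩
    exact ⟨hs, hU, fun i hi => (isZero_extEnv_iff k A i).2 (h0 i hi),
      ⟨((onBimodulesIso e (Env k A)).app (regularBimodule k (Env k A))).symm ≪≫
        tensorRegularIso k _⟩⟩

variable {k A}

/-- Both sides are the left derived functors of `Ext^d(A, -) ≅ U ⊗_{A^e} -`. -/
theorem IsTwistedCYWith.tor_iso {d : ℕ} {U : ModuleCat.{u} (Env k A)}
    (h : IsTwistedCYWith k A d U) {i : ℕ} (hi : i ≤ d) :
    Nonempty (torFunctor ((toRightEnv k A).obj U) i ≅ extFromRegular k A (d - i)) := by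
  obtain ⟨hs, -, h0, ⟨e⟩⟩ := (isTwistedCYWith_iff k A d U).1 h
  obtain ⟨e'⟩ := (freePresentation (Env k A)).leftDerived_ext_iso (regularBimodule k A) d
    (hs.subsingleton_ext d h0 (d + 1) (by omega))
    (fun j hj M => by
      have := h0 j hj.ne
      have := (freePresentation (Env k A)).projective M
      exact (hs.finitaryOnFree j).subsingleton_of_projective _) i hi
  exact ⟨leftDerivedIso e i ≪≫ e'⟩

/-- If `Ext^d(X, -)` preserves epimorphisms, then `X` has projective dimension at most `d`: embed
a module in an injective one and compare the connecting map with the zero map. -/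
theorem subsingleton_ext_of_epi {R : Type u} [Ring R] (X : ModuleCat.{u} R) (d : ℕ)
    (h : ∀ {M N : ModuleCat.{u} R} (f : M ⟶ N), Epi f → Epi ((extFunctorObj X d).map f))
    (i : ℕ) (hi : d < i) (M : ModuleCat.{u} R) : Subsingleton (Ext X M i) := by
  have := hasProjectiveDimensionLT_of_enoughInjectives X (d + 1) fun M => by
    refine subsingleton_of_forall_eq 0 fun x => ?_
    have hS : (ShortComplex.mk _ _ (Limits.cokernel.condition (Injective.ι M))).ShortExact :=
      { exact := ShortComplex.exact_cokernel _ }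
    obtain ⟨y, rfl⟩ := Ext.covariant_sequence_exact₁ X hS x (Ext.eq_zero_of_injective _) rfl
    obtain ⟨z, rfl⟩ := (AddCommGrpCat.epi_iff_surjective _).1
      (h (Limits.cokernel.π (Injective.ι M)) inferInstance) y
    have key (z : Ext X (Injective.under M) d) :
        (z.comp (Ext.mk₀ (Limits.cokernel.π (Injective.ι M))) (add_zero d)).comp
          hS.extClass rfl = 0 := by
      rw [Ext.comp_assoc_of_second_deg_zero, hS.comp_extClass, Ext.comp_zero]
    exact key z
  exact HasProjectiveDimensionLT.subsingleton X (d + 1) i hi M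

/-- Isomorphisms `Tor_i(U, -) ≅ Ext^{d-i}(A, -)` for `i ≤ d` force the twisted Calabi-Yau
property. -/
theorem isTwistedCYWith_of_tor_iso {d : ℕ} {U : ModuleCat.{u} (Env k A)} (hU : IsInvertible k U)
    (hs : HomologicallySmooth k A)
    (h : ∀ i, i ≤ d →
      Nonempty (torFunctor ((toRightEnv k A).obj U) i ≅ extFromRegular k A (d - i))) :
    IsTwistedCYWith k A d U := by
  obtain ⟨e⟩ := h 0 (Nat.zero_le d)
  have e' : tensorFunctor ((toRightEnv k A).obj U) ≅ extFromRegular k A d :=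
    (tensorFunctor ((toRightEnv k A).obj U)).leftDerivedZeroIsoSelf.symm ≪≫ e
  refine (isTwistedCYWith_iff k A d U).2 ⟨hs, hU, fun i hi => ?_, ⟨e'⟩⟩
  rcases hi.lt_or_gt with hi | hi
  · -- `Ext^i(A, A^e) ≅ Tor_{d-i}(U, A^e)` vanishes because `A^e` is projective and `d - i > 0`.
    obtain ⟨a⟩ := h (d - i) (by omega)
    rw [Nat.sub_sub_self hi.le, show d - i = (d - i - 1) + 1 by omega] at a
    have := (Functor.isZero_leftDerived_obj_projective_succ
      (tensorFunctor ((toRightEnv k A).obj U)) (d - i - 1) (regularLeft k (Env k A))).of_iso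
      (a.symm.app _)
    exact AddCommGrpCat.subsingleton_of_isZero this
  · -- `Ext^d(A, -)` is a tensor product functor, so it preserves epimorphisms.
    refine subsingleton_ext_of_epi (regularBimodule k A) d (fun {M N} f hf => ?_) i hi _
    have := NatIso.naturality_1 e' f
    rw [← this]
    infer_instance

end Criterion

/-! ### Full corners -/

section Corner

/-- An identification of an algebra `S` with a full corner `ε R ε` of an algebra `R`: a
multiplicative linear map `S → R` with `1 ↦ ε` and a linear retraction of it that is `r ↦ ε r ε`,
together with an expression of `1` as an element of the ideal `R ε R`. -/
structure FullCorner (k : Type v) [Field k] (S R : Type u) [Ring S] [Algebra k S] [Ring R]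
    [Algebra k R] where
  /-- The inclusion of `S` in `R`. -/
  incl : S →ₗ[k] R
  /-- The retraction `r ↦ ε r ε`. -/
  retr : R →ₗ[k] S
  incl_mul : ∀ s t, incl (s * t) = incl s * incl t
  retr_incl : ∀ s, retr (incl s) = s
  incl_retr : ∀ r, incl (retr r) = incl 1 * r * incl 1
  /-- The index set of the expression `1 = ∑ xᵢ ε yᵢ`. -/
  index : Type
  [fintype : Fintype index]
  /-- The left factors `xᵢ`. -/
  left : index → R
  /-- The right factors `yᵢ`. -/
  right : index → R
  sum_eq_one : ∑ i, left i * incl 1 * right i = 1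

attribute [instance] FullCorner.fintype

namespace FullCorner

variable {k : Type v} [Field k] {S R : Type u} [Ring S] [Algebra k S] [Ring R] [Algebra k R]
  (c : FullCorner k S R)

theorem incl_one_mul (s : S) : c.incl 1 * c.incl s = c.incl s := by
  rw [← c.incl_mul, one_mul]

theorem incl_mul_one (s : S) : c.incl s * c.incl 1 = c.incl s := by
  rw [← c.incl_mul, mul_one]

theorem incl_injective : Function.Injective c.incl :=
  Function.LeftInverse.injective c.retr_incl

theorem retr_mul (r : R) (s : S) : c.retr (r * c.incl s) = c.retr r * s := by
  apply c.incl_injective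
  rw [c.incl_retr, c.incl_mul, c.incl_retr, mul_assoc, mul_assoc (c.incl 1 * r), c.incl_one_mul,
    mul_assoc, c.incl_mul_one, mul_assoc]

theorem retr_incl_mul (s : S) (r : R) : c.retr (c.incl s * r) = s * c.retr r := by
  apply c.incl_injective
  rw [c.incl_retr, c.incl_mul, c.incl_retr, ← mul_assoc, ← mul_assoc, ← mul_assoc,
    c.incl_one_mul, c.incl_mul_one]

/-- The opposite of a full corner. -/
def op : FullCorner k Sᵐᵒᵖ Rᵐᵒᵖ where
  incl := (opLinearEquiv k).toLinearMap ∘ₗ c.incl ∘ₗ (opLinearEquiv k).symm.toLinearMap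
  retr := (opLinearEquiv k).toLinearMap ∘ₗ c.retr ∘ₗ (opLinearEquiv k).symm.toLinearMap
  incl_mul s t := congrArg MulOpposite.op (c.incl_mul (unop t) (unop s))
  retr_incl s := congrArg MulOpposite.op (c.retr_incl (unop s))
  incl_retr r := congrArg MulOpposite.op ((c.incl_retr (unop r)).trans (mul_assoc _ _ _))
  index := c.index
  left i := MulOpposite.op (c.right i)
  right i := MulOpposite.op (c.left i)
  sum_eq_one := by
    refine Eq.trans ?_ (congrArg MulOpposite.op c.sum_eq_one)
    rw [Finset.op_sum]
    exact Finset.sum_congr rfl fun i _ => congrArg MulOpposite.op (mul_assoc _ _ _).symm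

theorem op_incl (s : S) : c.op.incl (MulOpposite.op s) = MulOpposite.op (c.incl s) := rfl

/-- Transport of a full corner along an isomorphism of the small algebra. -/
def ofAlgEquiv {S' : Type u} [Ring S'] [Algebra k S'] (e : S' ≃ₐ[k] S) : FullCorner k S' R where
  incl := c.incl ∘ₗ e.toLinearMap
  retr := e.symm.toLinearMap ∘ₗ c.retr
  incl_mul s t := by simp [c.incl_mul]
  retr_incl s := by simp [c.retr_incl]
  incl_retr r := by simp [c.incl_retr]
  index := c.index
  left := c.left
  right := c.right
  sum_eq_one := by simpa using c.sum_eq_one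

section Fixed

variable (M : Type u) [AddCommGroup M] [Module R M]

/-- The subgroup `ε M` of an `R`-module `M`. -/
def fixed : AddSubgroup M where
  carrier := {m | c.incl 1 • m = m}
  zero_mem' := smul_zero _
  add_mem' {m n} (hm : _ = _) (hn : _ = _) := by
    change c.incl 1 • (m + n) = m + n
    rw [smul_add, hm, hn]
  neg_mem' {m} (hm : _ = _) := by
    change c.incl 1 • (-m) = -m
    rw [smul_neg, hm]

variable {M}

theorem smul_fixed (m : c.fixed M) : c.incl 1 • (m : M) = m := m.2

theorem incl_smul_mem (s : S) (m : M) : c.incl s • m ∈ c.fixed M := by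
  change c.incl 1 • c.incl s • m = c.incl s • m
  rw [smul_smul, c.incl_one_mul]

/-- `ε M` is a module over `S = ε R ε`. -/
instance : Module S (c.fixed M) where
  smul s m := ⟨c.incl s • (m : M), c.incl_smul_mem s (m : M)⟩
  one_smul m := Subtype.ext (c.smul_fixed m)
  mul_smul s t m := Subtype.ext ((congrArg (· • (m : M)) (c.incl_mul s t)).trans (mul_smul _ _ _))
  smul_zero s := Subtype.ext (smul_zero (c.incl s))
  smul_add s m n := Subtype.ext (smul_add (c.incl s) (m : M) n)
  add_smul s t m := Subtype.ext ((congrArg (· • (m : M)) (map_add c.incl s t)).trans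
    (add_smul _ _ _))
  zero_smul m := Subtype.ext ((congrArg (· • (m : M)) (map_zero c.incl)).trans (zero_smul _ _))

theorem coe_smul (s : S) (m : c.fixed M) : ((s • m : c.fixed M) : M) = c.incl s • (m : M) := rfl

/-- The projection `M → ε M`, `m ↦ ε m`. -/
def cut : M →+ c.fixed M :=
  AddMonoidHom.mk' (fun m => ⟨c.incl 1 • m, c.incl_smul_mem 1 m⟩)
    fun m n => Subtype.ext (smul_add _ m n)

theorem coe_cut (m : M) : (c.cut m : M) = c.incl 1 • m := rfl

theorem cut_coe (m : c.fixed M) : c.cut (m : M) = m := Subtype.ext m.2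

theorem cut_smul (r : R) (m : c.fixed M) : c.cut (r • (m : M)) = c.retr r • m := by
  apply Subtype.ext
  rw [coe_cut, coe_smul, incl_retr, mul_smul, mul_smul, c.smul_fixed]

theorem sum_left_smul_cut (m : M) : ∑ i, c.left i • (c.cut (c.right i • m) : M) = m := by
  conv_rhs => rw [← one_smul R m, ← c.sum_eq_one, Finset.sum_smul]
  exact Finset.sum_congr rfl fun i _ => by rw [coe_cut, mul_smul, mul_smul]

theorem cut_smul_eq_sum (r : R) (m : M) :
    c.cut (r • m) = ∑ j, c.retr (r * c.left j) • c.cut (c.right j • m) := by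
  conv_lhs => rw [← c.sum_left_smul_cut m, Finset.smul_sum, map_sum]
  exact Finset.sum_congr rfl fun j _ => by rw [smul_smul, cut_smul]

end Fixed

/-- The functor `M ↦ ε M` from left `R`-modules to left `S`-modules. -/
def functor : ModuleCat.{u} R ⥤ ModuleCat.{u} S where
  obj M := ModuleCat.of S (c.fixed M)
  map {M N} f := ModuleCat.ofHom
    { toFun := fun m => ⟨f.hom m, by
        change c.incl 1 • f.hom (m : M) = f.hom m
        rw [← map_smul, c.smul_fixed]⟩
      map_add' := fun m n => Subtype.ext (map_add f.hom (m : M) n)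
      map_smul' := fun s m => Subtype.ext (f.hom.map_smul (c.incl s) (m : M)) }

theorem coe_functor_map {M N : ModuleCat.{u} R} (f : M ⟶ N) (m : c.fixed M) :
    Subtype.val (p := (· ∈ c.fixed N)) ((c.functor.map f).hom m) = f.hom (m : M) := rfl

instance : c.functor.Additive where

/-- The extension to `M → N` of an `S`-linear map `g : ε M → ε N`, `m ↦ ∑ xᵢ g(ε yᵢ m)`. -/
def extend {M N : Type u} [AddCommGroup M] [Module R M] [AddCommGroup N] [Module R N]
    (g : c.fixed M →ₗ[S] c.fixed N) : M →ₗ[R] N where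
  toFun m := ∑ i, c.left i • (g (c.cut (c.right i • m)) : N)
  map_add' m n := by
    simp only [smul_add, map_add, AddSubgroup.coe_add, Finset.sum_add_distrib]
  map_smul' r m := by
    -- `ε yᵢ r m = ∑ⱼ (ε yᵢ r xⱼ ε) (ε yⱼ m)`, and `g` commutes with the elements of `ε R ε`.
    simp only [smul_smul, RingHom.id_apply, Finset.smul_sum]
    have (i : c.index) : (g (c.cut ((c.right i * r) • m)) : N) =
        ∑ j, (c.cut (c.right i • ((r * c.left j) • (g (c.cut (c.right j • m)) : N))) : N) := by
      rw [cut_smul_eq_sum, map_sum, AddSubgroup.val_finsetSum]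
      refine Finset.sum_congr rfl fun j _ => ?_
      rw [smul_smul, cut_smul, map_smul, mul_assoc]
    simp only [this, Finset.smul_sum]
    rw [Finset.sum_comm]
    exact Finset.sum_congr rfl fun j _ => c.sum_left_smul_cut _

theorem extend_coe {M N : Type u} [AddCommGroup M] [Module R M] [AddCommGroup N] [Module R N]
    (g : c.fixed M →ₗ[S] c.fixed N) (m : c.fixed M) : c.extend g (m : M) = g m := by
  change ∑ i, c.left i • (g (c.cut (c.right i • (m : M))) : N) = g m
  conv_rhs => rw [← c.sum_left_smul_cut (g m : N)]
  refine Finset.sum_congr rfl fun i _ => ?_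
  rw [cut_smul, cut_smul, map_smul]

instance : c.functor.Faithful where
  map_injective {M N f g} h := by
    ext m
    rw [← c.sum_left_smul_cut m, map_sum, map_sum]
    refine Finset.sum_congr rfl fun i _ => ?_
    rw [f.hom.map_smul, g.hom.map_smul, ← coe_functor_map, ← coe_functor_map, h]

instance : c.functor.Full where
  map_surjective {_ _} g :=
    ⟨ModuleCat.ofHom (c.extend g.hom), ModuleCat.hom_ext (LinearMap.ext fun m =>
      Subtype.ext (c.extend_coe g.hom m))⟩

variable {c} in
/-- The action of `r` on a linear map `g : ε R → N`, `(r g)(t) = g(t r)`. -/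
def coindSmul {N : Type u} [AddCommGroup N] [Module S N] (r : R) (g : c.fixed R →ₗ[S] N) :
    c.fixed R →ₗ[S] N where
  toFun t := g ⟨t * r, by
    change c.incl 1 * (t * r) = t * r
    rw [← mul_assoc]
    exact congrArg (· * r) t.2⟩
  map_add' s t := by
    rw [← map_add]
    exact congrArg g (Subtype.ext (add_mul _ _ _))
  map_smul' s t := by
    rw [RingHom.id_apply, ← map_smul]
    exact congrArg g (Subtype.ext (mul_assoc _ _ _))

/-- The coinduced module `Hom_S(ε R, N)`. -/
def Coind (N : Type u) [AddCommGroup N] [Module S N] : Type u := c.fixed R →ₗ[S] N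

section Coind

variable (N : Type u) [AddCommGroup N] [Module S N]

instance : AddCommGroup (c.Coind N) := inferInstanceAs (AddCommGroup (c.fixed R →ₗ[S] N))

variable {N} in
/-- The linear map `ε R → N` given by an element of the coinduced module. -/
def Coind.hom (g : c.Coind N) : c.fixed R →ₗ[S] N := g

instance : Module R (c.Coind N) where
  smul r g := coindSmul (c := c) (N := N) r (Coind.hom c g)
  one_smul g := LinearMap.ext fun t => congrArg (Coind.hom c g) (Subtype.ext (mul_one t.1))
  mul_smul _ _ g := LinearMap.ext fun t =>
    congrArg (Coind.hom c g) (Subtype.ext (mul_assoc t.1 _ _).symm)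
  smul_zero _ := rfl
  smul_add _ _ _ := rfl
  add_smul r s g := LinearMap.ext fun t =>
    (congrArg (Coind.hom c g) (Subtype.ext (mul_add t.1 _ _))).trans
      (map_add (Coind.hom c g) ⟨t.1 * r, _⟩ ⟨t.1 * s, _⟩)
  zero_smul g := LinearMap.ext fun t =>
    (congrArg (Coind.hom c g) (Subtype.ext (mul_zero t.1))).trans (map_zero (Coind.hom c g))

/-- The element `ε` of `ε R`. -/
def unit : c.fixed R := ⟨c.incl 1, by
  simpa using c.incl_smul_mem 1 (1 : R)⟩

theorem smul_unit (s : S) : s • c.unit = ⟨c.incl s, by simpa using c.incl_smul_mem s (1 : R)⟩ :=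
  Subtype.ext (c.incl_mul_one s)

/-- The isomorphism `ε Hom_S(ε R, N) ≅ N`, `g ↦ g(ε)`. -/
def fixedCoindEquiv : c.fixed (c.Coind N) ≃ₗ[S] N where
  toFun g := Coind.hom c g.1 c.unit
  map_add' g h := rfl
  map_smul' s g := by
    refine Eq.trans ?_ ((Coind.hom c g.1).map_smul s c.unit)
    rw [smul_unit]
    exact congrArg (Coind.hom c g.1) (Subtype.ext (c.incl_one_mul s))
  invFun n :=
    let g : c.fixed R →ₗ[S] N :=
      { toFun := fun t => c.retr t • n
        map_add' := fun s t => by rw [AddSubgroup.coe_add, map_add, add_smul]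
        map_smul' := fun s t => by
          rw [coe_smul, smul_eq_mul, retr_incl_mul, mul_smul, RingHom.id_apply] }
    ⟨g, LinearMap.ext (f := coindSmul (c := c) (c.incl 1) g) (g := g) fun t => by
      change c.retr (t * c.incl 1) • n = c.retr t • n
      rw [retr_mul, mul_one]⟩
  left_inv g := Subtype.ext (LinearMap.ext (g := Coind.hom c g.1) fun t => by
    change c.retr t • Coind.hom c g.1 c.unit = Coind.hom c g.1 t
    rw [← map_smul, smul_unit]
    refine Eq.trans (congrArg (Coind.hom c g.1) (Subtype.ext ?_))
      (LinearMap.congr_fun (f := coindSmul (c.incl 1) (Coind.hom c g.1)) g.2 t)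
    change c.incl (c.retr t) = t * c.incl 1
    rw [c.incl_retr]
    exact congrArg (· * c.incl 1) t.2)
  right_inv n := by
    change c.retr (c.incl 1) • n = n
    rw [retr_incl, one_smul]

end Coind

instance : c.functor.EssSurj where
  mem_essImage N := ⟨ModuleCat.of R (c.Coind N), ⟨(c.fixedCoindEquiv N).toModuleIso⟩⟩

/-- `M ↦ ε M` is an equivalence between left modules over an algebra and over a full corner. -/
instance : c.functor.IsEquivalence where

/-- A module is generated by the elements of any generating set of `ε M`. -/
theorem finite_of_finite_fixed (M : Type u) [AddCommGroup M] [Module R M]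
    [h : Module.Finite S (c.fixed M)] : Module.Finite R M := by
  obtain ⟨s, hs⟩ := h.fg_top
  classical
  refine ⟨s.image Subtype.val, eq_top_iff.2 fun m _ => ?_⟩
  rw [← c.sum_left_smul_cut m]
  refine Submodule.sum_mem _ fun i _ => Submodule.smul_mem _ _ ?_
  have key (n : c.fixed M) (hn : n ∈ Submodule.span S (s : Set (c.fixed M))) :
      (n : M) ∈ Submodule.span R (s.image Subtype.val : Set M) := by
    induction hn using Submodule.span_induction with
    | mem x hx =>
      exact Submodule.subset_span (Finset.mem_coe.2 (Finset.mem_image_of_mem _ hx))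
    | zero => exact zero_mem _
    | add x y _ _ hx hy => exact add_mem hx hy
    | smul r x _ hx => exact Submodule.smul_mem _ _ hx
  exact key _ (hs.symm ▸ Submodule.mem_top)

/-- If the `mⱼ` generate `M`, then the `ε yᵢ mⱼ` generate `ε M`. -/
theorem finite_fixed (M : Type u) [AddCommGroup M] [Module R M] [h : Module.Finite R M] :
    Module.Finite S (c.fixed M) := by
  obtain ⟨s, hs⟩ := h.fg_top
  classical
  refine ⟨(s ×ˢ (Finset.univ : Finset c.index)).image fun p => c.cut (c.right p.2 • p.1),
    eq_top_iff.2 fun m _ => ?_⟩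
  have key (n : M) (hn : n ∈ Submodule.span R (s : Set M)) : ∀ r : R,
      c.cut (r • n) ∈ Submodule.span S
        (((s ×ˢ (Finset.univ : Finset c.index)).image fun p => c.cut (c.right p.2 • p.1) :
          Finset (c.fixed M)) : Set (c.fixed M)) := by
    induction hn using Submodule.span_induction with
    | mem x hx =>
      intro r
      rw [cut_smul_eq_sum]
      exact Submodule.sum_mem _ fun j _ => Submodule.smul_mem _ _ (Submodule.subset_span
        (Finset.mem_coe.2 (Finset.mem_image.2 ⟨(x, j),
          Finset.mem_product.2 ⟨hx, Finset.mem_univ j⟩, rfl⟩)))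
    | zero => intro r; rw [smul_zero, map_zero]; exact zero_mem _
    | add x y _ _ hx hy => intro r; rw [smul_add, map_add]; exact add_mem (hx r) (hy r)
    | smul r x _ hx => intro r'; rw [smul_smul]; exact hx _
  have := key m (hs.symm ▸ Submodule.mem_top) 1
  rwa [one_smul, cut_coe] at this

end FullCorner

end Corner

/-! ### Equivalences of module categories and homological algebra -/

section Equivalence

open Abelian

variable {R S : Type u} [Ring R] [Ring S]

theorem IsPerfect.of_iso {M N : ModuleCat.{u} R} (h : IsPerfect M) (e : M ≅ N) :
    IsPerfect N := by
  obtain ⟨P, hP⟩ := h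
  exact ⟨{ complex := P.complex
           projective := P.projective
           π := P.π ≫ (ChainComplex.single₀ _).map e.hom }, hP⟩

theorem IsPerfect.map (F : ModuleCat.{u} R ⥤ ModuleCat.{u} S) [F.IsEquivalence] [F.Additive]
    (hF : ∀ M : ModuleCat.{u} R, Module.Finite R M → Module.Finite S (F.obj M))
    {M : ModuleCat.{u} R} (h : IsPerfect M) : IsPerfect (F.obj M) := by
  obtain ⟨P, hP, N, hN⟩ := h
  have : F.PreservesProjectiveObjects :=
    ⟨fun {X} hX => (F.asEquivalence.map_projective_iff X).2 hX⟩
  exact ⟨F.mapProjectiveResolution P, fun n => hF _ (hP n), N, fun n hn => F.map_isZero (hN n hn)⟩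

/-- An equivalence of module categories that preserves and reflects finite generation preserves
and reflects perfect modules. -/
theorem isPerfect_map_iff (F : ModuleCat.{u} R ⥤ ModuleCat.{u} S) [F.IsEquivalence] [F.Additive]
    (hF : ∀ M : ModuleCat.{u} R, Module.Finite R M ↔ Module.Finite S (F.obj M))
    (M : ModuleCat.{u} R) : IsPerfect (F.obj M) ↔ IsPerfect M := by
  refine ⟨fun h => ?_, IsPerfect.map F fun M => (hF M).1⟩
  have hinv : F.inv.Additive := F.inv.additive_of_preserves_binary_products
  refine (h.map F.inv fun N hN => ?_).of_iso (F.asEquivalence.unitIso.app M).symm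
  have : Module.Finite S ((𝟭 (ModuleCat.{u} S)).obj N) := hN
  rw [hF]
  exact Module.Finite.equiv (F.asEquivalence.counitIso.app N).symm.toLinearEquiv

/-- An equivalence `F` of module categories induces `Ext^n(X, M) ≅ Ext^n(F X, F M)`, naturally
in `M`. -/
def extEquivalenceIso (F : ModuleCat.{u} R ⥤ ModuleCat.{u} S) [F.IsEquivalence] [F.Additive]
    (X : ModuleCat.{u} R) (n : ℕ) : extFunctorObj X n ≅ F ⋙ extFunctorObj (F.obj X) n :=
  have : F.PreservesProjectiveObjects :=
    ⟨fun {X} hX => (F.asEquivalence.map_projective_iff X).2 hX⟩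
  NatIso.ofComponents
    (fun M => (AddEquiv.ofBijective (F.mapExtAddHom X M n)
      (F.mapExt_bijective_of_preservesProjectiveObjects X M n)).toAddCommGrpIso)
    fun {M N} f => AddCommGrpCat.hom_ext (AddMonoidHom.ext fun x => by
      have key (x : Ext X M n) : (x.comp (Ext.mk₀ f) (add_zero n)).mapExactFunctor F =
          (x.mapExactFunctor F).comp (Ext.mk₀ (F.map f)) (add_zero n) := by
        rw [Ext.mapExactFunctor_comp, Ext.mapExactFunctor_mk₀]
      exact key x)

/-- `Ext^n(X, -)` depends on `X` only up to isomorphism. -/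
def extIsoOfIso {X Y : ModuleCat.{u} R} (e : X ≅ Y) (n : ℕ) :
    extFunctorObj X n ≅ extFunctorObj Y n :=
  (extFunctor n).mapIso e.symm.op

theorem nonempty_iso_of_comp_iso {D : Type*} [Category* D] (F : ModuleCat.{u} R ⥤ ModuleCat.{u} S)
    [F.IsEquivalence] {G H : ModuleCat.{u} S ⥤ D} (e : F ⋙ G ≅ F ⋙ H) : Nonempty (G ≅ H) :=
  ⟨G.leftUnitor.symm ≪≫ Functor.isoWhiskerRight F.asEquivalence.counitIso.symm G ≪≫
    Functor.isoWhiskerLeft F.inv e ≪≫ Functor.isoWhiskerRight F.asEquivalence.counitIso H ≪≫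
    H.leftUnitor⟩

end Equivalence

/-! ### Tensor products over full corners -/

section CornerTensor

theorem btmul_sum {R : Type u} [Ring R] {X : Type u} [AddCommGroup X] [Module Rᵐᵒᵖ X]
    {Y : Type u} [AddCommGroup Y] [Module R Y] {ι : Type*} (s : Finset ι) (x : X) (f : ι → Y) :
    (btmul x (∑ i ∈ s, f i) : BalancedTensor R X Y) = ∑ i ∈ s, btmul x (f i) :=
  map_sum (btmulHom x) f s

theorem sum_btmul {R : Type u} [Ring R] {X : Type u} [AddCommGroup X] [Module Rᵐᵒᵖ X]
    {Y : Type u} [AddCommGroup Y] [Module R Y] {ι : Type*} (s : Finset ι) (f : ι → X) (y : Y) :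
    (btmul (∑ i ∈ s, f i) y : BalancedTensor R X Y) = ∑ i ∈ s, btmul (f i) y :=
  map_sum (btmulHom.flip y) f s

variable {k : Type v} [Field k] {S R : Type u} [Ring S] [Algebra k S] [Ring R] [Algebra k R]

/-- An `S`-module `M₀` exhibited as a piece of an `R`-module `M`, where `S = ε R ε`: the image of
`M₀` in `M` is that of the map `m ↦ π (ε m)`, for an `R`-linear endomorphism `π` of `M`. With
`π = 1` this says that `M₀ ≅ ε M`; for bimodules, `π` cuts down the action on the other side. -/
structure FullCorner.Piece (c : FullCorner k S R) (M₀ M : Type u) [AddCommGroup M₀] [Module S M₀]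
    [AddCommGroup M] [Module R M] where
  /-- The inclusion of the piece. -/
  incl : M₀ →+ M
  /-- The projection to the piece. -/
  retr : M →+ M₀
  /-- The endomorphism `π`. -/
  proj : M →ₗ[R] M
  retr_incl : ∀ m, retr (incl m) = m
  incl_retr : ∀ m, incl (retr m) = proj (c.incl 1 • m)
  incl_smul : ∀ s m, incl (s • m) = c.incl s • incl m

namespace FullCorner.Piece

variable {c : FullCorner k S R} {M₀ M : Type u} [AddCommGroup M₀] [Module S M₀]
    [AddCommGroup M] [Module R M] (p : c.Piece M₀ M)

theorem incl_injective : Function.Injective p.incl :=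
  Function.LeftInverse.injective p.retr_incl

theorem smul_incl (m : M₀) : c.incl 1 • p.incl m = p.incl m := by
  rw [← p.incl_smul, one_smul]

theorem proj_incl (m : M₀) : p.proj (p.incl m) = p.incl m := by
  conv_rhs => rw [← p.retr_incl m, p.incl_retr, p.smul_incl]

theorem retr_incl_smul (s : S) (m : M) : p.retr (c.incl s • m) = s • p.retr m := by
  apply p.incl_injective
  rw [p.incl_retr, p.incl_smul, p.incl_retr, ← map_smul, smul_smul, smul_smul, c.incl_one_mul,
    c.incl_mul_one]

theorem retr_smul_incl (r : R) (m : M₀) : p.retr (r • p.incl m) = c.retr r • m := by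
  apply p.incl_injective
  rw [p.incl_retr, p.incl_smul, c.incl_retr, mul_smul, mul_smul, p.smul_incl, map_smul, map_smul,
    p.proj_incl]

theorem retr_smul_eq_sum (r : R) (m : M) :
    p.retr (r • m) = ∑ j, c.retr (r * c.left j) • p.retr (c.right j • m) := by
  have h : r • m = ∑ j, (r * c.left j) • c.incl 1 • c.right j • m := by
    conv_lhs => rw [← one_smul R m, ← c.sum_eq_one, Finset.sum_smul, Finset.smul_sum]
    exact Finset.sum_congr rfl fun i _ => by simp only [smul_smul, mul_assoc]
  rw [h, map_sum]
  refine Finset.sum_congr rfl fun j _ => ?_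
  rw [← one_smul S (p.retr _), ← p.retr_incl_smul, ← p.retr_incl_smul, c.incl_retr]
  simp only [smul_smul, mul_assoc]

theorem sum_retr_smul (m : M) : ∑ j, c.retr (c.left j) • p.retr (c.right j • m) = p.retr m := by
  have h := p.retr_smul_eq_sum 1 m
  simp only [one_smul, one_mul] at h
  exact h.symm

variable {X₀ X : Type u} [AddCommGroup X₀] [Module Sᵐᵒᵖ X₀] [AddCommGroup X] [Module Rᵐᵒᵖ X]
  (q : c.op.Piece X₀ X)

/-- The map `X₀ ⊗_S M₀ → X ⊗_R M` for pieces `X₀` of `X` and `M₀` of `M`. -/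
def tensorIncl : BalancedTensor S X₀ M₀ →+ BalancedTensor R X M :=
  BalancedTensor.lift (AddMonoidHom.mk' (fun x => AddMonoidHom.mk' (fun m =>
      btmul (q.incl x) (p.incl m)) fun m n => by rw [map_add, btmul_add])
    fun x y => AddMonoidHom.ext fun m =>
      (congrArg (fun z => btmul z (p.incl m)) (map_add q.incl x y)).trans (add_btmul _ _ _))
    fun x s m => by
      change btmul (q.incl (MulOpposite.op s • x)) (p.incl m) =
        btmul (q.incl x) (p.incl (s • m))
      rw [q.incl_smul, c.op_incl, btmul_balanced, p.incl_smul]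

theorem tensorIncl_btmul (x : X₀) (m : M₀) :
    tensorIncl p q (btmul x m) = btmul (q.incl x) (p.incl m) := rfl

/-- The map `X ⊗_R M → X₀ ⊗_S M₀`, `x ⊗ m ↦ ∑ x xᵢ ε ⊗ ε yᵢ m` (up to the endomorphisms `π`). -/
def tensorRetr : BalancedTensor R X M →+ BalancedTensor S X₀ M₀ :=
  BalancedTensor.lift (AddMonoidHom.mk' (fun x => AddMonoidHom.mk' (fun m =>
      ∑ i, btmul (q.retr (MulOpposite.op (c.left i) • x)) (p.retr (c.right i • m)))
      fun m n => by simp only [smul_add, map_add, btmul_add, Finset.sum_add_distrib])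
    fun x y => AddMonoidHom.ext fun m => by
      refine Eq.trans ?_ Finset.sum_add_distrib
      refine Finset.sum_congr rfl fun i _ => ?_
      rw [smul_add, map_add, add_btmul])
    fun x r m => by
      change ∑ i, btmul (q.retr (MulOpposite.op (c.left i) • MulOpposite.op r • x))
          (p.retr (c.right i • m)) =
        ∑ j, btmul (q.retr (MulOpposite.op (c.left j) • x)) (p.retr (c.right j • r • m))
      -- Both sides are `∑ x xⱼ ε ⊗ (ε yⱼ r xᵢ ε) yᵢ m`.
      have hl (i : c.index) : q.retr (MulOpposite.op (c.left i) • MulOpposite.op r • x) =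
          ∑ j, MulOpposite.op (c.retr (c.right j * r * c.left i)) •
            q.retr (MulOpposite.op (c.left j) • x) := by
        rw [smul_smul, q.retr_smul_eq_sum]
        refine Finset.sum_congr rfl fun j _ => ?_
        rw [mul_assoc]
        rfl
      simp only [hl, sum_btmul, btmul_balanced]
      rw [Finset.sum_comm]
      refine Finset.sum_congr rfl fun j _ => ?_
      rw [smul_smul, p.retr_smul_eq_sum, btmul_sum]

theorem tensorRetr_btmul (x : X) (m : M) : tensorRetr p q (btmul x m) =
    ∑ i, btmul (q.retr (MulOpposite.op (c.left i) • x)) (p.retr (c.right i • m)) := rfl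

theorem tensorRetr_tensorIncl (t : BalancedTensor S X₀ M₀) :
    tensorRetr p q (tensorIncl p q t) = t := by
  induction t using BalancedTensor.induction with
  | zero => rw [map_zero, map_zero]
  | tmul x m =>
    rw [tensorIncl_btmul, tensorRetr_btmul]
    have (i : c.index) : q.retr (MulOpposite.op (c.left i) • q.incl x) =
        MulOpposite.op (c.retr (c.left i)) • x := q.retr_smul_incl _ _
    simp only [this, btmul_balanced]
    rw [← btmul_sum, p.sum_retr_smul, p.retr_incl]
  | add s t hs ht => rw [map_add, map_add, hs, ht]

theorem tensorIncl_tensorRetr_btmul (x : X) (m : M) :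
    tensorIncl p q (tensorRetr p q (btmul x m)) = btmul (q.proj x) (p.proj m) := by
  rw [tensorRetr_btmul, map_sum]
  conv_rhs => rw [← one_smul R (p.proj m), ← c.sum_eq_one, Finset.sum_smul, btmul_sum]
  refine Finset.sum_congr rfl fun i _ => ?_
  rw [tensorIncl_btmul, q.incl_retr, p.incl_retr, map_smul, map_smul, map_smul, map_smul]
  have : c.op.incl 1 = MulOpposite.op (c.incl 1) := rfl
  rw [this, btmul_balanced, btmul_balanced, smul_smul (c.incl 1), ← c.incl_mul, one_mul, mul_smul,
    mul_smul]

end FullCorner.Piece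

/-- The submodule `ε M`, as a piece of `M`. -/
def FullCorner.fixedPiece (c : FullCorner k S R) (M : Type u) [AddCommGroup M] [Module R M] :
    c.Piece (c.fixed M) M where
  incl := (c.fixed M).subtype
  retr := c.cut
  proj := LinearMap.id
  retr_incl := c.cut_coe
  incl_retr := c.coe_cut
  incl_smul := c.coe_smul

/-- The functor `X ⊗_R -` in terms of the functor `X₀ ⊗_S -`, if `X₀ = X ε`. -/
def FullCorner.tensorFunctorIso (c : FullCorner k S R) {X₀ : ModuleCat.{u} Sᵐᵒᵖ}
    {X : ModuleCat.{u} Rᵐᵒᵖ} (q : c.op.Piece X₀ X) (hq : q.proj = LinearMap.id) :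
    c.functor ⋙ tensorFunctor X₀ ≅ tensorFunctor X :=
  NatIso.ofComponents (fun M => AddEquiv.toAddCommGrpIso
      { FullCorner.Piece.tensorIncl (c.fixedPiece M) q with
        invFun := FullCorner.Piece.tensorRetr (c.fixedPiece M) q
        left_inv := FullCorner.Piece.tensorRetr_tensorIncl (c.fixedPiece M) q
        right_inv := fun t => by
          change FullCorner.Piece.tensorIncl (c.fixedPiece M) q
            (FullCorner.Piece.tensorRetr (c.fixedPiece M) q t) = t
          induction t using BalancedTensor.induction with
          | zero => rw [map_zero, map_zero]
          | tmul x m =>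
            rw [FullCorner.Piece.tensorIncl_tensorRetr_btmul, hq]
            rfl
          | add s t hs ht => rw [map_add, map_add, hs, ht] })
    fun {M N} f => AddCommGrpCat.hom_ext (BalancedTensor.hom_ext fun x m => rfl)

end CornerTensor

/-! ### Tensor products of bimodules -/

section BimoduleTensor

/-- The map `X ⊗_R Y → X' ⊗_R Y'`, `x ⊗ y ↦ f x ⊗ g y`. -/
def BalancedTensor.mapBoth {R : Type u} [Ring R] {X X' Y Y' : Type u} [AddCommGroup X]
    [Module Rᵐᵒᵖ X] [AddCommGroup X'] [Module Rᵐᵒᵖ X'] [AddCommGroup Y] [Module R Y]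
    [AddCommGroup Y'] [Module R Y'] (f : X →ₗ[Rᵐᵒᵖ] X') (g : Y →ₗ[R] Y') :
    BalancedTensor R X Y →+ BalancedTensor R X' Y' :=
  BalancedTensor.lift (AddMonoidHom.mk' (fun x => AddMonoidHom.mk' (fun y => btmul (f x) (g y))
      fun y y' => by rw [map_add, btmul_add])
    fun x x' => AddMonoidHom.ext fun y =>
      (congrArg (fun z => btmul z (g y)) (map_add f x x')).trans (add_btmul _ _ _))
    fun x r y => by
      change btmul (f (op r • x)) (g y) = btmul (f x) (g (r • y))
      rw [map_smul, map_smul, btmul_balanced]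

variable {k : Type v} [Field k] {A : Type u} [Ring A] [Algebra k A]

theorem tmul_smul_eq (M : ModuleCat.{u} (Env k A)) (a : A) (b : Aᵐᵒᵖ) (m : M) :
    (a ⊗ₜ[k] b : Env k A) • m = a ⊗ₜ[k] (1 : Aᵐᵒᵖ) • ((1 : A) ⊗ₜ[k] b • m) := by
  rw [smul_smul, Algebra.TensorProduct.tmul_mul_tmul, mul_one, one_mul]

theorem tmul_smul_eq' (M : ModuleCat.{u} (Env k A)) (a : A) (b : Aᵐᵒᵖ) (m : M) :
    (a ⊗ₜ[k] b : Env k A) • m = (1 : A) ⊗ₜ[k] b • (a ⊗ₜ[k] (1 : Aᵐᵒᵖ) • m) := by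
  rw [smul_smul, Algebra.TensorProduct.tmul_mul_tmul, mul_one, one_mul]

/-- An additive map between bimodules that commutes with both actions is linear over `A^e`. -/
def envLinearMap {M N : Type u} [AddCommGroup M] [Module (Env k A) M] [AddCommGroup N]
    [Module (Env k A) N] (f : M →+ N)
    (h : ∀ (a : A) (b : Aᵐᵒᵖ) (m : M), f (a ⊗ₜ[k] b • m) = a ⊗ₜ[k] b • f m) :
    M →ₗ[Env k A] N where
  toFun := f
  map_add' := map_add f
  map_smul' r m := by
    change f (r • m) = r • f m
    induction r using TensorProduct.induction_on with
    | zero =>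
      exact (congrArg f (zero_smul (Env k A) m)).trans
        ((map_zero f).trans (zero_smul (Env k A) (f m)).symm)
    | tmul a b => exact h a b m
    | add x y hx hy => rw [add_smul, add_smul, map_add, hx, hy]

/-- Left multiplication by `a` on a bimodule, as a map of right modules. -/
def leftAct (U : ModuleCat.{u} (Env k A)) (a : A) :
    (rightPart k A).obj U →ₗ[Aᵐᵒᵖ] (rightPart k A).obj U where
  toFun := fun u : U => a ⊗ₜ[k] (1 : Aᵐᵒᵖ) • u
  map_add' := fun u u' : U => smul_add (a ⊗ₜ[k] (1 : Aᵐᵒᵖ)) u u'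
  map_smul' b u := (tmul_smul_eq U a b u).symm.trans (tmul_smul_eq' U a b u)

/-- Right multiplication by `b` on a bimodule, as a map of left modules. -/
def rightAct (V : ModuleCat.{u} (Env k A)) (b : Aᵐᵒᵖ) :
    (leftPart k A).obj V →ₗ[A] (leftPart k A).obj V where
  toFun := fun v : V => (1 : A) ⊗ₜ[k] b • v
  map_add' := fun v v' : V => smul_add ((1 : A) ⊗ₜ[k] b) v v'
  map_smul' a v := (tmul_smul_eq' V a b v).symm.trans (tmul_smul_eq V a b v)

variable (U V : ModuleCat.{u} (Env k A))

/-- The abelian group `U ⊗_A V`, for bimodules `U` and `V`. -/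
def BimoduleTensor : Type u := BalancedTensor A ((rightPart k A).obj U) ((leftPart k A).obj V)

namespace BimoduleTensor

instance : AddCommGroup (BimoduleTensor U V) := inferInstanceAs
  (AddCommGroup (BalancedTensor A ((rightPart k A).obj U) ((leftPart k A).obj V)))

/-- The pure tensor `u ⊗ v` of elements of bimodules. -/
def tmul {U V : ModuleCat.{u} (Env k A)} (u : U) (v : V) : BimoduleTensor U V :=
  btmul (X := (rightPart k A).obj U) (Y := (leftPart k A).obj V) u v

variable {U V}

@[elab_as_elim]
theorem induction {p : BimoduleTensor U V → Prop} (t : BimoduleTensor U V)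
    (zero : p 0) (tmul : ∀ (u : U) (v : V), p (tmul u v)) (add : ∀ s t, p s → p t → p (s + t)) :
    p t :=
  BalancedTensor.induction t zero tmul add

theorem hom_ext {G : Type*} [AddCommGroup G] {f g : BimoduleTensor U V →+ G}
    (h : ∀ (u : U) (v : V), f (tmul u v) = g (tmul u v)) : f = g :=
  AddMonoidHom.ext fun t => by
    induction t using BimoduleTensor.induction with
    | zero => rw [map_zero, map_zero]
    | tmul u v => exact h u v
    | add s t hs ht => rw [map_add, map_add, hs, ht]

theorem add_tmul (u u' : U) (v : V) : tmul (u + u') v = tmul u v + tmul u' v :=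
  add_btmul (X := (rightPart k A).obj U) (Y := (leftPart k A).obj V) u u' v

theorem tmul_add (u : U) (v v' : V) : tmul u (v + v') = tmul u v + tmul u v' :=
  btmul_add (X := (rightPart k A).obj U) (Y := (leftPart k A).obj V) u v v'

theorem smul_tmul_eq (a : A) (u : U) (v : V) :
    tmul ((1 : A) ⊗ₜ[k] op a • u) v = tmul u (a ⊗ₜ[k] (1 : Aᵐᵒᵖ) • v) :=
  btmul_balanced (X := (rightPart k A).obj U) (Y := (leftPart k A).obj V) u a v

/-- The action of `a ⊗ b` on `U ⊗_A V`, through the left action on `U` and the right action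
on `V`. -/
def act (a : A) (b : Aᵐᵒᵖ) : BimoduleTensor U V →+ BimoduleTensor U V :=
  BalancedTensor.mapBoth (leftAct U a) (rightAct V b)

theorem act_tmul (a : A) (b : Aᵐᵒᵖ) (u : U) (v : V) :
    act a b (tmul u v) = tmul (a ⊗ₜ[k] (1 : Aᵐᵒᵖ) • u) ((1 : A) ⊗ₜ[k] b • v) := rfl

theorem act_one : act (U := U) (V := V) 1 1 = AddMonoidHom.id _ := hom_ext fun u v => by
  rw [act_tmul, ← Algebra.TensorProduct.one_def, one_smul, one_smul]
  rfl

theorem act_mul (a a' : A) (b b' : Aᵐᵒᵖ) :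
    act (U := U) (V := V) (a * a') (b * b') = (act a b).comp (act a' b') := hom_ext fun u v => by
  change _ = act a b (act a' b' (tmul u v))
  rw [act_tmul, act_tmul, act_tmul, smul_smul, smul_smul, Algebra.TensorProduct.tmul_mul_tmul,
    Algebra.TensorProduct.tmul_mul_tmul, one_mul, one_mul]

/-- The action of `A ⊗ A^op` on `U ⊗_A V` as a biadditive map. -/
def actHom : A →+ Aᵐᵒᵖ →+ AddMonoid.End (BimoduleTensor U V) :=
  AddMonoidHom.mk' (fun a => AddMonoidHom.mk' (fun b => act a b)
      fun b b' => hom_ext fun u v => by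
        change act a (b + b') (tmul u v) = act a b (tmul u v) + act a b' (tmul u v)
        rw [act_tmul, act_tmul, act_tmul, TensorProduct.tmul_add, add_smul, tmul_add])
    fun a a' => AddMonoidHom.ext fun b => hom_ext fun u v => by
      change act (a + a') b (tmul u v) = act a b (tmul u v) + act a' b (tmul u v)
      rw [act_tmul, act_tmul, act_tmul, TensorProduct.add_tmul, add_smul, add_tmul]

theorem act_smul (r : k) (a : A) (b : Aᵐᵒᵖ) :
    act (U := U) (V := V) (r • a) b = act a (r • b) := hom_ext fun u v => by
  have h : (r • a) ⊗ₜ[k] (1 : Aᵐᵒᵖ) • u =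
      (1 : A) ⊗ₜ[k] op (algebraMap k A r) • (a ⊗ₜ[k] (1 : Aᵐᵒᵖ) • u) := by
    rw [smul_smul, Algebra.TensorProduct.tmul_mul_tmul, one_mul, mul_one, TensorProduct.smul_tmul,
      Algebra.smul_def, mul_one]
    rfl
  rw [act_tmul, act_tmul, h, smul_tmul_eq, smul_smul, Algebra.TensorProduct.tmul_mul_tmul,
    mul_one, one_mul, Algebra.algebraMap_eq_smul_one, TensorProduct.smul_tmul]

variable (U V) in
/-- The additive map `A^e → End(U ⊗_A V)`. -/
def actAddHom : Env k A →+ AddMonoid.End (BimoduleTensor U V) :=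
  TensorProduct.liftAddHom actHom fun r a b => act_smul r a b

theorem actAddHom_tmul (a : A) (b : Aᵐᵒᵖ) : actAddHom U V (a ⊗ₜ[k] b) = act a b := rfl

variable (U V) in
/-- The ring homomorphism `A^e → End(U ⊗_A V)`. -/
def actRingHom : Env k A →+* AddMonoid.End (BimoduleTensor U V) :=
  RingHom.mk' ⟨⟨actAddHom U V, by
      rw [Algebra.TensorProduct.one_def, actAddHom_tmul, act_one]
      rfl⟩, fun x y => by
    change actAddHom U V (x * y) = actAddHom U V x * actAddHom U V y
    induction x using TensorProduct.induction_on with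
    | zero =>
      exact (congrArg _ (zero_mul y)).trans ((map_zero (actAddHom U V)).trans
        ((congrArg (· * actAddHom U V y) (map_zero (actAddHom U V))).trans (zero_mul _)).symm)
    | tmul a b =>
      induction y using TensorProduct.induction_on with
      | zero =>
        exact (congrArg _ (mul_zero (a ⊗ₜ[k] b))).trans ((map_zero (actAddHom U V)).trans
          ((congrArg (actAddHom U V (a ⊗ₜ[k] b) * ·) (map_zero (actAddHom U V))).trans
            (mul_zero _)).symm)
      | tmul a' b' =>
        rw [Algebra.TensorProduct.tmul_mul_tmul, actAddHom_tmul, actAddHom_tmul, actAddHom_tmul,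
          act_mul]
        rfl
      | add y y' hy hy' => rw [mul_add, map_add, map_add, mul_add, hy, hy']
    | add x x' hx hx' => rw [add_mul, map_add, map_add, add_mul, hx, hx']⟩ (map_add (actAddHom U V))

instance : Module (Env k A) (BimoduleTensor U V) := Module.compHom _ (actRingHom U V)

end BimoduleTensor

theorem tensorIsoRegular_iff : TensorIsoRegular k U V ↔
    Nonempty (ModuleCat.of (Env k A) (BimoduleTensor U V) ≅ regularBimodule k A) := by
  constructor
  · rintro ⟨e : BimoduleTensor U V ≃+ A, he⟩
    let f : BimoduleTensor U V →ₗ[Env k A] regularBimodule k A :=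
      envLinearMap (N := regularBimodule k A) e.toAddMonoidHom fun a b t => by
        change e _ = _
        refine Eq.trans ?_ (regularBimodule_smul k A a (unop b) (e t)).symm
        induction t using BimoduleTensor.induction with
        | zero => rw [smul_zero, map_zero, mul_zero, zero_mul]
        | tmul u v => exact he a (unop b) u v
        | add s t hs ht => rw [smul_add, map_add, map_add, mul_add, add_mul, hs, ht]
    exact ⟨(LinearEquiv.ofBijective f e.bijective).toModuleIso⟩
  · rintro ⟨e⟩
    refine ⟨e.toLinearEquiv.toAddEquiv, fun a b u v => ?_⟩
    exact (e.toLinearEquiv.map_smul (a ⊗ₜ[k] op b : Env k A) (BimoduleTensor.tmul u v)).trans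
      (regularBimodule_smul k A a b _)

variable {U V}

theorem TensorIsoRegular.of_iso {U' V' : ModuleCat.{u} (Env k A)} (h : TensorIsoRegular k U V)
    (i : U ≅ U') (j : V ≅ V') : TensorIsoRegular k U' V' := by
  obtain ⟨e, he⟩ := h
  let f : ∀ {U U' V V' : ModuleCat.{u} (Env k A)} (_ : U ⟶ U') (_ : V ⟶ V'),
      BimoduleTensor U V →+ BimoduleTensor U' V' := fun g h =>
    BalancedTensor.mapBoth ((rightPart k A).map g).hom ((leftPart k A).map h).hom
  have hf : ∀ {U U' V V' : ModuleCat.{u} (Env k A)} (i : U ≅ U') (j : V ≅ V') (t),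
      f i.inv j.inv (f i.hom j.hom t) = t := fun i j t => by
    induction t using BimoduleTensor.induction with
    | zero => rw [map_zero, map_zero]
    | tmul u v =>
      change BimoduleTensor.tmul (i.inv.hom (i.hom.hom u)) (j.inv.hom (j.hom.hom v)) = _
      rw [ModuleCat.inv_hom_apply, ModuleCat.inv_hom_apply]
    | add s t hs ht => rw [map_add, map_add, hs, ht]
  let E : BimoduleTensor U' V' ≃+ BimoduleTensor U V :=
    { f i.inv j.inv with
      invFun := f i.hom j.hom
      left_inv := hf i.symm j.symm
      right_inv := hf i j }
  refine ⟨E.trans e, fun a b u v => ?_⟩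
  refine Eq.trans ?_ (he a b (i.inv.hom u) (j.inv.hom v))
  rw [← map_smul, ← map_smul]
  rfl

theorem IsInvertible.of_iso {U' : ModuleCat.{u} (Env k A)} (h : IsInvertible k U) (i : U ≅ U') :
    IsInvertible k U' := by
  obtain ⟨V, h1, h2⟩ := h
  exact ⟨V, h1.of_iso i (Iso.refl V), h2.of_iso (Iso.refl V) i⟩

end BimoduleTensor

/-! ### Bimodules over full corners -/

section CornerBimodule

variable {k : Type v} [Field k]

/-- The tensor product of two full corners. -/
def FullCorner.tensor {S R S' R' : Type u} [Ring S] [Algebra k S] [Ring R] [Algebra k R]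
    [Ring S'] [Algebra k S'] [Ring R'] [Algebra k R'] (c : FullCorner k S R)
    (c' : FullCorner k S' R') : FullCorner k (S ⊗[k] S') (R ⊗[k] R') where
  incl := TensorProduct.map c.incl c'.incl
  retr := TensorProduct.map c.retr c'.retr
  incl_mul x y := by
    induction x using TensorProduct.induction_on with
    | zero => rw [zero_mul, map_zero, zero_mul]
    | tmul a b =>
      induction y using TensorProduct.induction_on with
      | zero => rw [mul_zero, map_zero, mul_zero]
      | tmul a' b' => simp [c.incl_mul, c'.incl_mul]
      | add y y' hy hy' => rw [mul_add, map_add, map_add, mul_add, hy, hy']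
    | add x x' hx hx' => rw [add_mul, map_add, map_add, add_mul, hx, hx']
  retr_incl x := by
    induction x using TensorProduct.induction_on with
    | zero => rw [map_zero, map_zero]
    | tmul a b => simp [c.retr_incl, c'.retr_incl]
    | add x x' hx hx' => rw [map_add, map_add, hx, hx']
  incl_retr x := by
    rw [Algebra.TensorProduct.one_def, TensorProduct.map_tmul]
    induction x using TensorProduct.induction_on with
    | zero => rw [mul_zero, zero_mul, map_zero, map_zero]
    | tmul a b => simp [c.incl_retr, c'.incl_retr]
    | add x x' hx hx' => rw [map_add, map_add, mul_add, add_mul, hx, hx']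
  index := c.index × c'.index
  left i := c.left i.1 ⊗ₜ c'.left i.2
  right i := c.right i.1 ⊗ₜ c'.right i.2
  sum_eq_one := by
    simp only [Algebra.TensorProduct.one_def, TensorProduct.map_tmul,
      Algebra.TensorProduct.tmul_mul_tmul]
    rw [← c.sum_eq_one, ← c'.sum_eq_one, TensorProduct.sum_tmul, Fintype.sum_prod_type]
    exact Finset.sum_congr rfl fun i _ => by rw [TensorProduct.tmul_sum]

namespace FullCorner

variable {A L : Type u} [Ring A] [Algebra k A] [Ring L] [Algebra k L] (c : FullCorner k A L)

/-- The full corner of enveloping algebras induced by a full corner. -/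
def env : FullCorner k (Env k A) (Env k L) := c.tensor c.op

theorem env_incl_tmul (a b : A) :
    c.env.incl (a ⊗ₜ[k] MulOpposite.op b) = c.incl a ⊗ₜ[k] MulOpposite.op (c.incl b) := rfl

theorem env_incl_one : c.env.incl 1 = c.incl 1 ⊗ₜ[k] MulOpposite.op (c.incl 1) := rfl

theorem envOp_incl (s : (Env k A)ᵐᵒᵖ) :
    envOp k L (c.env.op.incl s) = c.env.incl (envOp k A s) := by
  induction s using MulOpposite.rec' with
  | _ s =>
  rw [op_incl]
  induction s using TensorProduct.induction_on with
  | zero => simp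
  | tmul a b =>
    induction b using MulOpposite.rec' with
    | _ b => rw [env_incl_tmul, envOp_tmul, envOp_tmul, env_incl_tmul]
  | add x y hx hy => rw [map_add, MulOpposite.op_add, map_add, hx, hy, MulOpposite.op_add, map_add,
      map_add]

/-- The bimodule `ε L ε` is `A`. -/
def regularBimoduleIso : c.env.functor.obj (regularBimodule k L) ≅ regularBimodule k A :=
  have hfix (m : c.env.fixed (regularBimodule k L)) :
      HMul.hMul (α := L) (HMul.hMul (β := L) (c.incl 1) m.1) (c.incl 1) = m.1 :=
    (regularBimodule_smul k L _ _ _).symm.trans m.2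
  have hsmul (a b : A) (m : L) : c.retr (c.incl a * m * c.incl b) = a * c.retr m * b := by
    rw [c.retr_mul, c.retr_incl_mul]
  have hmem (a : A) : c.incl 1 * c.incl a * c.incl 1 = c.incl a := by
    rw [c.incl_one_mul, c.incl_mul_one]
  let f : c.env.fixed (regularBimodule k L) ≃+ A :=
    { toFun := fun m => c.retr m.1
      invFun := fun a => ⟨c.incl a, (regularBimodule_smul k L _ _ _).trans (hmem a)⟩
      left_inv := fun m => Subtype.ext ((c.incl_retr m.1).trans (hfix m))
      right_inv := c.retr_incl
      map_add' := fun m n => map_add c.retr m.1 n.1 }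
  let g : c.env.fixed (regularBimodule k L) →ₗ[Env k A] regularBimodule k A :=
    envLinearMap f.toAddMonoidHom fun a b m =>
      ((congrArg c.retr (regularBimodule_smul k L (c.incl a) (c.incl (unop b)) m.1)).trans
        (hsmul a (unop b) m.1)).trans (regularBimodule_smul k A a (unop b) (f m)).symm
  (LinearEquiv.ofBijective g f.bijective).toModuleIso

/-- The right `A^e`-module `ε U ε` is a piece of the right `L^e`-module `U`. -/
def rightEnvPiece (U : ModuleCat.{u} (Env k L)) :
    c.env.op.Piece ((toRightEnv k A).obj (c.env.functor.obj U)) ((toRightEnv k L).obj U) where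
  incl := (c.env.fixed U).subtype
  retr := c.env.cut (M := U)
  proj := LinearMap.id
  retr_incl := c.env.cut_coe (M := U)
  incl_retr m := congrArg (fun r : Env k L => HSMul.hSMul (β := U) (γ := U) r m)
    (show c.env.incl 1 = envOp k L (c.env.op.incl 1) by rw [envOp_incl, map_one (envOp k A)])
  incl_smul s m := by
    change _ = HSMul.hSMul (β := U) (γ := U) (envOp k L (c.env.op.incl s)) _
    rw [envOp_incl]
    rfl

theorem smul_left_fixed (V : ModuleCat.{u} (Env k L)) (a : A) (v : c.env.fixed V) :
    (c.incl a ⊗ₜ[k] MulOpposite.op (c.incl 1)) • (v : V) =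
      (c.incl a ⊗ₜ[k] (1 : Lᵐᵒᵖ)) • (v : V) := by
  conv_rhs => rw [← c.env.smul_fixed v, env_incl_one, smul_smul,
    Algebra.TensorProduct.tmul_mul_tmul, one_mul, c.incl_mul_one]

theorem smul_right_fixed (V : ModuleCat.{u} (Env k L)) (b : A) (v : c.env.fixed V) :
    (c.incl 1 ⊗ₜ[k] MulOpposite.op (c.incl b)) • (v : V) =
      ((1 : L) ⊗ₜ[k] MulOpposite.op (c.incl b)) • (v : V) := by
  conv_rhs => rw [← c.env.smul_fixed v, env_incl_one, smul_smul,
    Algebra.TensorProduct.tmul_mul_tmul, one_mul, ← MulOpposite.op_mul, c.incl_one_mul]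

/-- The left `A`-module `ε V ε` is a piece of the left `L`-module `V`. -/
def leftPiece (V : ModuleCat.{u} (Env k L)) :
    c.Piece ((leftPart k A).obj (c.env.functor.obj V)) ((leftPart k L).obj V) where
  incl := (c.env.fixed V).subtype
  retr := c.env.cut (M := V)
  proj := rightAct V (MulOpposite.op (c.incl 1))
  retr_incl := c.env.cut_coe (M := V)
  incl_retr m := tmul_smul_eq' V (c.incl 1) (MulOpposite.op (c.incl 1)) m
  incl_smul s m := c.smul_left_fixed V s m

/-- The right `A`-module `ε U ε` is a piece of the right `L`-module `U`. -/
def rightPiece (U : ModuleCat.{u} (Env k L)) :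
    c.op.Piece ((rightPart k A).obj (c.env.functor.obj U)) ((rightPart k L).obj U) where
  incl := (c.env.fixed U).subtype
  retr := c.env.cut (M := U)
  proj := leftAct U (c.incl 1)
  retr_incl := c.env.cut_coe (M := U)
  incl_retr m := tmul_smul_eq U (c.incl 1) (MulOpposite.op (c.incl 1)) m
  incl_smul s m := c.smul_right_fixed U (unop s) m

/-- The inclusion of `ε U ε ⊗_A ε V ε` in `U ⊗_L V`. -/
def bimoduleTensorIncl (U V : ModuleCat.{u} (Env k L)) :
    BimoduleTensor (c.env.functor.obj U) (c.env.functor.obj V) →+ BimoduleTensor U V :=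
  (c.leftPiece V).tensorIncl (c.rightPiece U)

/-- The projection of `U ⊗_L V` to `ε U ε ⊗_A ε V ε`. -/
def bimoduleTensorRetr (U V : ModuleCat.{u} (Env k L)) :
    BimoduleTensor U V →+ BimoduleTensor (c.env.functor.obj U) (c.env.functor.obj V) :=
  (c.leftPiece V).tensorRetr (c.rightPiece U)

theorem bimoduleTensorIncl_retr (U V : ModuleCat.{u} (Env k L)) (t : BimoduleTensor U V) :
    c.bimoduleTensorIncl U V (c.bimoduleTensorRetr U V t) = c.env.incl 1 • t := by
  induction t using BimoduleTensor.induction with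
  | zero => rw [map_zero, map_zero, smul_zero]
  | tmul u v => exact (c.leftPiece V).tensorIncl_tensorRetr_btmul (c.rightPiece U) u v
  | add s t hs ht => rw [map_add, map_add, smul_add, hs, ht]

theorem bimoduleTensorRetr_incl (U V : ModuleCat.{u} (Env k L))
    (t : BimoduleTensor (c.env.functor.obj U) (c.env.functor.obj V)) :
    c.bimoduleTensorRetr U V (c.bimoduleTensorIncl U V t) = t :=
  (c.leftPiece V).tensorRetr_tensorIncl (c.rightPiece U) t

theorem bimoduleTensorIncl_smul (U V : ModuleCat.{u} (Env k L)) (a : A) (b : Aᵐᵒᵖ)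
    (t : BimoduleTensor (c.env.functor.obj U) (c.env.functor.obj V)) :
    c.bimoduleTensorIncl U V (a ⊗ₜ[k] b • t) =
      c.env.incl (a ⊗ₜ[k] b) • c.bimoduleTensorIncl U V t := by
  induction t using BimoduleTensor.induction with
  | zero => rw [smul_zero, map_zero, smul_zero]
  | tmul u v =>
    exact congrArg₂ BimoduleTensor.tmul (c.smul_left_fixed U a u)
      (c.smul_right_fixed V (unop b) v)
  | add s t hs ht => rw [smul_add, map_add, map_add, smul_add, hs, ht]

/-- The isomorphism `ε (U ⊗_L V) ε ≅ ε U ε ⊗_A ε V ε` of bimodules. -/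
def bimoduleTensorIso (U V : ModuleCat.{u} (Env k L)) :
    ModuleCat.of (Env k A) (BimoduleTensor (c.env.functor.obj U) (c.env.functor.obj V)) ≅
      c.env.functor.obj (ModuleCat.of (Env k L) (BimoduleTensor U V)) :=
  have hfix (t) : c.bimoduleTensorIncl U V t ∈ c.env.fixed (BimoduleTensor U V) := by
    change c.env.incl 1 • _ = _
    rw [← bimoduleTensorIncl_retr, bimoduleTensorRetr_incl]
  let f : BimoduleTensor (c.env.functor.obj U) (c.env.functor.obj V) ≃+
      c.env.fixed (BimoduleTensor U V) :=
    { toFun := fun t => ⟨c.bimoduleTensorIncl U V t, hfix t⟩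
      invFun := fun t => c.bimoduleTensorRetr U V t.1
      left_inv := c.bimoduleTensorRetr_incl U V
      right_inv := fun t => Subtype.ext ((c.bimoduleTensorIncl_retr U V t.1).trans t.2)
      map_add' := fun s t => Subtype.ext (map_add _ s t) }
  let g : BimoduleTensor (c.env.functor.obj U) (c.env.functor.obj V) →ₗ[Env k A]
      c.env.fixed (BimoduleTensor U V) :=
    envLinearMap f.toAddMonoidHom fun a b t => Subtype.ext (c.bimoduleTensorIncl_smul U V a b t)
  (LinearEquiv.ofBijective g f.bijective).toModuleIso

theorem tensorIsoRegular_iff (U V : ModuleCat.{u} (Env k L)) :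
    TensorIsoRegular k (c.env.functor.obj U) (c.env.functor.obj V) ↔ TensorIsoRegular k U V := by
  rw [TwistedCY.tensorIsoRegular_iff, TwistedCY.tensorIsoRegular_iff]
  exact ⟨fun ⟨e⟩ => ⟨c.env.functor.preimageIso
      ((c.bimoduleTensorIso U V).symm ≪≫ e ≪≫ c.regularBimoduleIso.symm)⟩,
    fun ⟨e⟩ => ⟨c.bimoduleTensorIso U V ≪≫ c.env.functor.mapIso e ≪≫ c.regularBimoduleIso⟩⟩

theorem isInvertible_iff (U : ModuleCat.{u} (Env k L)) :
    IsInvertible k (c.env.functor.obj U) ↔ IsInvertible k U := by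
  constructor
  · rintro ⟨V, h1, h2⟩
    have i := (c.env.functor.objObjPreimageIso V).symm
    exact ⟨c.env.functor.objPreimage V,
      (c.tensorIsoRegular_iff _ _).1 (h1.of_iso (Iso.refl _) i),
      (c.tensorIsoRegular_iff _ _).1 (h2.of_iso i (Iso.refl _))⟩
  · rintro ⟨V, h1, h2⟩
    exact ⟨c.env.functor.obj V, (c.tensorIsoRegular_iff _ _).2 h1,
      (c.tensorIsoRegular_iff _ _).2 h2⟩

theorem homologicallySmooth_iff (c : FullCorner k A L) :
    HomologicallySmooth k A ↔ HomologicallySmooth k L := by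
  have h := isPerfect_map_iff c.env.functor (fun M =>
    ⟨fun h => c.env.finite_fixed M, fun h => c.env.finite_of_finite_fixed M (h := h)⟩)
    (regularBimodule k L)
  exact ⟨fun hA => h.1 (IsPerfect.of_iso hA c.regularBimoduleIso.symm),
    fun hL => IsPerfect.of_iso (h.2 hL) c.regularBimoduleIso⟩

/-- The isomorphism `Ext^i_{L^e}(L, M) ≅ Ext^i_{A^e}(A, ε M ε)`. -/
def extFromRegularIso (i : ℕ) :
    extFromRegular k L i ≅ c.env.functor ⋙ extFromRegular k A i :=
  extEquivalenceIso c.env.functor (regularBimodule k L) i ≪≫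
    Functor.isoWhiskerLeft c.env.functor (extIsoOfIso c.regularBimoduleIso i)

theorem subsingleton_extFromRegular_iff (c : FullCorner k A L) (h : HomologicallySmooth k A)
    (i : ℕ) :
    Subsingleton ((extFromRegular k A i).obj (regularLeft k (Env k A))) ↔
      Subsingleton ((extFromRegular k L i).obj (regularLeft k (Env k L))) := by
  have e (M : ModuleCat.{u} (Env k L)) : (extFromRegular k L i).obj M ≃
      (extFromRegular k A i).obj (c.env.functor.obj M) :=
    (((c.extFromRegularIso i).app M).addCommGroupIsoToAddEquiv).toEquiv
  constructor
  · intro h0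
    have : Projective (c.env.functor.obj (regularLeft k (Env k L))) :=
      (c.env.functor.asEquivalence.map_projective_iff _).2 inferInstance
    have := (h.finitaryOnFree i).subsingleton_of_projective
      (c.env.functor.obj (regularLeft k (Env k L)))
    exact (e _).subsingleton
  · intro h0
    let Q := c.env.functor.objPreimage (regularLeft k (Env k A))
    let j : c.env.functor.obj Q ≅ regularLeft k (Env k A) := c.env.functor.objObjPreimageIso _
    have : Projective Q :=
      (c.env.functor.asEquivalence.map_projective_iff _).1 (Projective.of_iso j.symm inferInstance)
    have := ((c.homologicallySmooth_iff.1 h).finitaryOnFree i).subsingleton_of_projective Q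
    have := (e Q).symm.subsingleton
    exact ((extFromRegular k A i).mapIso j).symm.addCommGroupIsoToAddEquiv.toEquiv.subsingleton

/-- The functors `U ⊗_{L^e} -` and `ε U ε ⊗_{A^e} -` correspond to each other. -/
def tensorEnvIso (U : ModuleCat.{u} (Env k L)) :
    c.env.functor ⋙ tensorFunctor ((toRightEnv k A).obj (c.env.functor.obj U)) ≅
      tensorFunctor ((toRightEnv k L).obj U) :=
  c.env.tensorFunctorIso (c.rightEnvPiece U) rfl

theorem isTwistedCYWith_iff (d : ℕ) (U : ModuleCat.{u} (Env k L)) :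
    IsTwistedCYWith k A d (c.env.functor.obj U) ↔ IsTwistedCYWith k L d U := by
  rw [TwistedCY.isTwistedCYWith_iff, TwistedCY.isTwistedCYWith_iff]
  constructor
  · rintro ⟨h, hU, h0, ⟨e⟩⟩
    exact ⟨c.homologicallySmooth_iff.1 h, (c.isInvertible_iff U).1 hU,
      fun i hi => (c.subsingleton_extFromRegular_iff h i).1 (h0 i hi),
      ⟨(c.tensorEnvIso U).symm ≪≫ Functor.isoWhiskerLeft c.env.functor e ≪≫
        (c.extFromRegularIso d).symm⟩⟩
  · rintro ⟨h, hU, h0, ⟨e⟩⟩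
    have h' := c.homologicallySmooth_iff.2 h
    exact ⟨h', (c.isInvertible_iff U).2 hU,
      fun i hi => (c.subsingleton_extFromRegular_iff h' i).2 (h0 i hi),
      nonempty_iso_of_comp_iso c.env.functor
        (c.tensorEnvIso U ≪≫ e ≪≫ c.extFromRegularIso d)⟩

/-- The twisted Calabi-Yau property passes between an algebra and its full corners. -/
theorem isTwistedCY_iff (c : FullCorner k A L) (d : ℕ) : IsTwistedCY k A d ↔ IsTwistedCY k L d := by
  constructor
  · rintro ⟨U, h⟩
    have i := (c.env.functor.objObjPreimageIso U).symm
    refine ⟨c.env.functor.objPreimage U, (c.isTwistedCYWith_iff d _).1 ?_⟩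
    exact ⟨h.smooth, h.invertible.of_iso i, h.ext_eq_zero,
      h.ext_iso.map fun e => e ≪≫ (toRightEnv k A).mapIso i⟩
  · rintro ⟨U, h⟩
    exact ⟨_, (c.isTwistedCYWith_iff d U).2 h⟩

end FullCorner

end CornerBimodule

/-! ### Morita equivalent algebras as full corners of one algebra -/

section FiniteFactor

variable {C : Type*} [Category* C] [Preadditive C]

/-- A morphism is a finite sum of morphisms that factor through the object `X`. -/
def FactorsFinitely (X : C) {Y Z : C} (f : Y ⟶ Z) : Prop :=
  ∃ (ι : Type) (_ : Fintype ι) (u : ι → (Y ⟶ X)) (v : ι → (X ⟶ Z)), ∑ i, u i ≫ v i = f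

namespace FactorsFinitely

variable {X Y Z : C}

theorem of_comp (u : Y ⟶ X) (v : X ⟶ Z) : FactorsFinitely X (u ≫ v) :=
  ⟨Unit, inferInstance, fun _ => u, fun _ => v, by simp⟩

theorem zero : FactorsFinitely X (0 : Y ⟶ Z) :=
  ⟨Empty, inferInstance, Empty.rec, Empty.rec, by simp⟩

theorem add {f g : Y ⟶ Z} (hf : FactorsFinitely X f) (hg : FactorsFinitely X g) :
    FactorsFinitely X (f + g) := by
  obtain ⟨ι, _, u, v, rfl⟩ := hf
  obtain ⟨ι', _, u', v', rfl⟩ := hg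
  exact ⟨ι ⊕ ι', inferInstance, Sum.elim u u', Sum.elim v v', by simp⟩

theorem comp {f : Y ⟶ Z} (hf : FactorsFinitely X f) {Y' Z' : C} (a : Y' ⟶ Y) (b : Z ⟶ Z') :
    FactorsFinitely X (a ≫ f ≫ b) := by
  obtain ⟨ι, _, u, v, rfl⟩ := hf
  exact ⟨ι, inferInstance, fun i => a ≫ u i, fun i => v i ≫ b, by
    simp [Preadditive.comp_sum, Preadditive.sum_comp]⟩

theorem of_iso {f : Y ⟶ Z} (hf : FactorsFinitely X f) {X' : C} (e : X ≅ X') :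
    FactorsFinitely X' f := by
  obtain ⟨ι, _, u, v, rfl⟩ := hf
  exact ⟨ι, inferInstance, fun i => u i ≫ e.hom, fun i => e.inv ≫ v i, by simp⟩

theorem map {f : Y ⟶ Z} (hf : FactorsFinitely X f) {D : Type*} [Category* D] [Preadditive D]
    (F : C ⥤ D) [F.Additive] : FactorsFinitely (F.obj X) (F.map f) := by
  obtain ⟨ι, _, u, v, rfl⟩ := hf
  exact ⟨ι, inferInstance, fun i => F.map (u i), fun i => F.map (v i), by simp [F.map_sum]⟩

end FactorsFinitely

end FiniteFactor

section Linking

variable {k : Type v} [Field k]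

/-- If `X` is a direct summand of `W` and the identity of `W` is a finite sum of maps that factor
through `X`, then `End X` is a full corner of `End W`. -/
theorem FactorsFinitely.nonempty_fullCorner {C : Type*} [Category.{u} C] [Preadditive C]
    [Linear k C] {X W : C} (i : X ⟶ W) (p : W ⟶ X) (h : i ≫ p = 𝟙 X)
    (hW : FactorsFinitely X (𝟙 W)) : Nonempty (FullCorner k (End X) (End W)) := by
  obtain ⟨ι, _, u, v, huv⟩ := hW
  exact ⟨{
    incl :=
      { toFun := fun f => p ≫ f ≫ i
        map_add' := (by simp : ∀ f g : X ⟶ X, p ≫ (f + g) ≫ i = p ≫ f ≫ i + p ≫ g ≫ i)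
        map_smul' := (by simp : ∀ (r : k) (f : X ⟶ X), p ≫ (r • f) ≫ i = r • (p ≫ f ≫ i)) }
    retr :=
      { toFun := fun f => i ≫ f ≫ p
        map_add' := (by simp : ∀ f g : W ⟶ W, i ≫ (f + g) ≫ p = i ≫ f ≫ p + i ≫ g ≫ p)
        map_smul' := (by simp : ∀ (r : k) (f : W ⟶ W), i ≫ (r • f) ≫ p = r • (i ≫ f ≫ p)) }
    incl_mul := fun f g => by simp [End.mul_def, reassoc_of% h]
    retr_incl := fun f => by simp [reassoc_of% h, h]
    incl_retr := fun f => by simp [End.mul_def, End.one_def]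
    index := ι
    left := fun j => p ≫ v j
    right := fun j => u j ≫ i
    sum_eq_one := by
      refine Eq.trans (Finset.sum_congr rfl fun j _ => ?_) huv
      simp [End.mul_def, End.one_def, reassoc_of% h] }⟩

variable (k) in
theorem isSeparator_regularLeft (R : Type u) [Ring R] [Algebra k R] :
    IsSeparator (regularLeft k R) := by
  rw [isSeparator_def]
  intro M N f g h
  ext m
  have := ConcreteCategory.congr_hom (h (ofElement k m)) (regEquiv k 1)
  rw [ofElement_comp, ofElement_comp] at this
  simpa using this

/-- Every module is the sum of the images of the maps from a separator: modulo this sum, all such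
maps become zero. -/
theorem span_image_of_isSeparator {R : Type u} [Ring R] {G : ModuleCat.{u} R} (hG : IsSeparator G)
    (N : ModuleCat.{u} R) : Submodule.span R {x : N | ∃ (f : G ⟶ N) (y : G), f.hom y = x} = ⊤ := by
  set I := Submodule.span R {x : N | ∃ (f : G ⟶ N) (y : G), f.hom y = x} with hI
  have h : ModuleCat.ofHom I.mkQ = 0 := (isSeparator_def _).1 hG _ _ fun f => by
    ext y
    exact (Submodule.Quotient.mk_eq_zero I).2 (Submodule.subset_span ⟨f, y, rfl⟩)
  exact eq_top_iff.2 fun x _ =>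
    (Submodule.Quotient.mk_eq_zero I).1 (ConcreteCategory.congr_hom h x)

/-- If `G` is a separator of the category of left `R`-modules, then its trace ideal is `R`, so the
identity of `R` is a finite sum of maps that factor through `G`. -/
theorem factorsFinitely_of_isSeparator (R : Type u) [Ring R] [Algebra k R] (G : ModuleCat.{u} R)
    (hG : IsSeparator G) : FactorsFinitely G (𝟙 (regularLeft k R)) := by
  have key (x : regularLeft k R) (hx : x ∈ Submodule.span R
      {x : regularLeft k R | ∃ (f : G ⟶ regularLeft k R) (y : G), f.hom y = x}) :
      FactorsFinitely G (ofElement k x) := by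
    induction hx using Submodule.span_induction with
    | mem x hx =>
      obtain ⟨f, y, rfl⟩ := hx
      rw [← ofElement_comp]
      exact .of_comp _ _
    | zero =>
      have : ofElement k (0 : regularLeft k R) = 0 :=
        regularLeft_hom_ext k fun r => smul_zero r
      rw [this]
      exact .zero
    | add x y _ _ hx hy => rw [ofElement_add]; exact hx.add hy
    | smul r x _ hx =>
      rw [← rightMul_comp_ofElement]
      simpa using hx.comp (rightMul (regularBimodule k R) (op r)) (𝟙 _)
  have h1 : 𝟙 (regularLeft k R) = ofElement k (regEquiv k 1) :=
    regularLeft_hom_ext k fun r => by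
      rw [ofElement_apply, smul_regEquiv, mul_one]
      rfl
  rw [h1]
  exact key _ (span_image_of_isSeparator hG (regularLeft k R) ▸ Submodule.mem_top)

open scoped ModuleCat.Algebra

variable (k) in
/-- The endomorphism algebra of the left module `R` is the opposite of `R`. -/
def regularEndEquiv (R : Type u) [Ring R] [Algebra k R] :
    R ≃ₐ[k] (End (regularLeft k R))ᵐᵒᵖ :=
  AlgEquiv.ofLinearEquiv
    { toFun := fun r => op (ofElement k (regEquiv k r))
      invFun := fun f => (regEquiv k).symm ((unop f).hom (regEquiv k 1))
      map_add' := fun r s => by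
        rw [map_add, ofElement_add]
        rfl
      map_smul' := fun c r => congrArg op (regularLeft_hom_ext k fun s => by
        change s • regEquiv k (c • r) = algebraMap k R c • (s • regEquiv k r)
        rw [smul_regEquiv, smul_regEquiv, smul_regEquiv, mul_smul_comm, Algebra.smul_def])
      left_inv := fun r => by
        change (regEquiv k).symm ((ofElement k (regEquiv k r)).hom (regEquiv k 1)) = r
        rw [ofElement_apply, smul_regEquiv, one_mul, AddEquiv.symm_apply_apply]
      right_inv := fun f => congrArg op (regularLeft_hom_ext k fun s => by
        change s • regEquiv k ((regEquiv k).symm ((unop f).hom (regEquiv k 1))) = _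
        rw [AddEquiv.apply_symm_apply, ← (unop f).hom.map_smul, smul_regEquiv, mul_one]
        rfl) }
    (congrArg op (regularLeft_hom_ext k fun s => by
      change s • regEquiv k 1 = regEquiv k s
      rw [smul_regEquiv, mul_one]))
    fun r r' => congrArg op (regularLeft_hom_ext k fun s => by
      change s • regEquiv k (r * r') = (ofElement k (regEquiv k r')).hom (s • regEquiv k r)
      rw [smul_regEquiv, smul_regEquiv, ofElement_apply, smul_regEquiv, mul_assoc])

/-- A full faithful linear functor induces isomorphisms of endomorphism algebras. -/
def endEquiv {C D : Type*} [Category* C] [Preadditive C] [Linear k C] [Category* D]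
    [Preadditive D] [Linear k D] (F : C ⥤ D) [F.Additive] [F.Linear k] [F.Full] [F.Faithful]
    (X : C) : End X ≃ₐ[k] End (F.obj X) :=
  AlgEquiv.ofLinearEquiv
    { (Functor.FullyFaithful.ofFullyFaithful F).homEquiv (X := X) (Y := X) with
      map_add' := fun _ _ => F.map_add
      map_smul' := fun r f => F.map_smul r f }
    (F.map_id X) fun f g => F.map_comp g f

/-- The twisted Calabi-Yau property is Morita invariant. With `P = A` and `Q` the `A`-module that
corresponds to the `B`-module `B`, both `A ≅ (End P)ᵒᵖ` and `B ≅ (End Q)ᵒᵖ` are full corners of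
`(End (P ⊕ Q))ᵒᵖ`, since `P` and `Q` are separators. -/
theorem isTwistedCY_iff_of_isMoritaEquivalent {A B : Type u} [Ring A] [Algebra k A] [Ring B]
    [Algebra k B] (h : IsMoritaEquivalent k A B) (d : ℕ) :
    IsTwistedCY k A d ↔ IsTwistedCY k B d := by
  obtain ⟨⟨E, hE⟩⟩ := h
  have : E.functor.Additive := E.functor.additive_of_preserves_binary_products
  have : E.inverse.Additive := E.inverse.additive_of_preserves_binary_products
  let P : ModuleCat.{u} A := regularLeft k A
  let Q : ModuleCat.{u} A := E.inverse.obj (regularLeft k B)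
  have hP : FactorsFinitely Q (𝟙 P) := factorsFinitely_of_isSeparator A Q
    ((isSeparator_regularLeft k B).of_equivalence E.symm)
  have hQ : FactorsFinitely P (𝟙 Q) := by
    have h1 := ((factorsFinitely_of_isSeparator (k := k) B (E.functor.obj P)
      ((isSeparator_regularLeft k A).of_equivalence E)).map E.inverse).of_iso
      (E.unitIso.app P).symm
    rwa [E.inverse.map_id] at h1
  have hPW : FactorsFinitely P (𝟙 (P ⊞ Q)) := by
    rw [← Limits.biprod.total]
    exact (FactorsFinitely.of_comp _ _).add
      (by simpa using hQ.comp Limits.biprod.snd Limits.biprod.inr)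
  have hQW : FactorsFinitely Q (𝟙 (P ⊞ Q)) := by
    rw [← Limits.biprod.total]
    exact (by simpa using hP.comp Limits.biprod.fst Limits.biprod.inl :
      FactorsFinitely Q _).add (FactorsFinitely.of_comp _ _)
  obtain ⟨a⟩ := hPW.nonempty_fullCorner (k := k) Limits.biprod.inl Limits.biprod.fst (by simp)
  obtain ⟨b⟩ := hQW.nonempty_fullCorner (k := k) Limits.biprod.inr Limits.biprod.snd (by simp)
  rw [(a.op.ofAlgEquiv (regularEndEquiv k A)).isTwistedCY_iff d, (b.op.ofAlgEquiv
    ((regularEndEquiv k B).trans (AlgEquiv.op (endEquiv E.inverse _)))).isTwistedCY_iff d]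

end Linking

end TwistedCY

end

theorem mainTheorem12 {k : Type v} [Field k] {A : Type u} [Ring A] [Algebra k A] (d : ℕ) :
    (∀ U : ModuleCat.{u} (TwistedCY.Env k A), TwistedCY.IsInvertible k U →
      (TwistedCY.IsTwistedCYWith k A d U ↔
        TwistedCY.HomologicallySmooth k A ∧
          ∀ (C : Type u) [Ring C] [Algebra k C] (i : ℕ), i ≤ d →
            Nonempty
              ((TwistedCY.onBimodules
                  (TwistedCY.torFunctor ((TwistedCY.toRightEnv k A).obj U) i) :
                  ModuleCat.{u} (TwistedCY.Env k A ⊗[k] Cᵐᵒᵖ) ⥤ ModuleCat.{u} Cᵐᵒᵖ) ≅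
                TwistedCY.onBimodules (TwistedCY.extFromRegular k A (d - i))))) ∧
    ∀ (B : Type u) [Ring B] [Algebra k B], IsMoritaEquivalent k A B →
      (TwistedCY.IsTwistedCY k A d ↔ TwistedCY.IsTwistedCY k B d) := by
  refine ⟨fun U hU => ⟨fun h => ⟨h.smooth, fun C _ _ i hi => ?_⟩, fun ⟨hs, h⟩ => ?_⟩,
    fun B _ _ h => TwistedCY.isTwistedCY_iff_of_isMoritaEquivalent h d⟩
  · exact (h.tor_iso hi).map fun e => TwistedCY.onBimodulesIso e C
  · exact TwistedCY.isTwistedCYWith_of_tor_iso hU hs fun i hi =>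
      TwistedCY.iso_of_onBimodules_iso fun C => h C i hi
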